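/- Consider a single-server queue with infinite buffer whose arrivals follow a Markov-modulated Poisson process. The phase process is an irreducible continuous-time Markov chain on $\mathcal S=\{1,\dots,L\}$ with generator $Q$ and stationary probabilities $p_1,\dots,p_L$; in phase $s$ jobs arrive at rate $\lambda_s\ge 0$. Each job has an exponential service requirement with mean $1$. A stationary policy $\pi$ chooses in state $(n,s)$ ($n$ jobs in the system, phase $s$) a service rate $\mu(n,s)\in[0,\bar u]$, $\bar u<\infty$, with $\mu(0,s)=0$. Under $\pi$ the state $X(t)$ is a continuous-time Markov chain on $\{0,1,2,\dots\}\times\mathcal S$ with transitions $(n,s)\to(n+1,s)$ at rate $\lambda_s$, $(n,s)\to(n-1,s)$ at rate $\mu(n,s)$ (for $n\ge1$), and $(n,s)\to(n,s')$ at rate $Q_{ss'}$ ($s'\ne s$). Costs accrue at rate $c(\mu(n,s))+h(n)$ in state $(n,s)$, where $c$ is strictly convex, continuously differentiable and strictly increasing on $[0,\bar u]$ with $c(0)=0$, and $h$ is convex and non-decreasing with $h(0)=0$, $\lim_{n\to\infty}h(n)=\infty$ and $h(n)\le Cn^k$ for some constants $C\ge0$ and $k\in\{0,1,2,\dots\}$.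 The long-run average cost of $\pi$ from initial state $x$ is $$g^\pi(x)=\limsup_{t\to\infty}\frac1t\,\mathbb E_x^\pi\Big[\int_0^t \big(c(\mu(X(u)))+h(N(u))\big)\,du\Big],$$ where $N(u)$ is the number of jobs in the system at time $u$. The system is called stable under $\pi$ if the chain $X$ has a stationary probability distribution (a steady state). Assume that $\bar u>0$ or that $\lambda_s>0$ for some $s$. Then there exists a stationary policy under which the system is stable if and only if $$\bar u>\sum_{s=1}^L p_s\lambda_s .$$ Moreover, for every constant $\hat\mu\in\big(\sum_{s}p_s\lambda_s,\ \bar u\big]$, the system is stable under the stationary policy $\hat\pi$ that uses the rate $\hat\mu$ whenever the queue is non-empty, and the long-run average cost $g^{\hat\pi}(x)$ is finite and does not depend on the initial state $x$. -/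

import Mathlib

open MeasureTheory ProbabilityTheory Filter
open scoped ENNReal NNReal

noncomputable section

namespace MMPPQueue

/-- `Q` is the generator (rate matrix) of a continuous-time Markov chain on `Fin L`. -/
structure IsGenerator {L : ℕ} (Q : Matrix (Fin L) (Fin L) ℝ) : Prop where
  offDiag_nonneg : ∀ s r, s ≠ r → 0 ≤ Q s r
  row_sum : ∀ s, ∑ r, Q s r = 0

/-- Every state can be reached from every state through transitions of positive rate.  On a finite
state space this is ergodicity of the continuous-time Markov chain with generator `Q`. -/
def IsIrreducible {L : ℕ} (Q : Matrix (Fin L) (Fin L) ℝ) : Prop :=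
  ∀ s r, Relation.ReflTransGen (fun a b => 0 < Q a b) s r

/-- `p` is a stationary probability vector of the chain with generator `Q`. -/
structure IsStationaryVector {L : ℕ} (Q : Matrix (Fin L) (Fin L) ℝ) (p : Fin L → ℝ) : Prop where
  nonneg : ∀ s, 0 ≤ p s
  sum_one : ∑ s, p s = 1
  balance : ∀ r, ∑ s, p s * Q s r = 0

end MMPPQueue

/-- The data of the MMPP/M/1 queue with service rate control and the standing assumptions
(average-cost case).  Jobs have exponential service requirements of mean one; in phase `s` they
arrive at rate `lam s`; the server works at a rate chosen from `[0, ubar]`. -/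
structure MMPPQueue (L : ℕ) where
  /-- generator of the phase process -/
  Q : Matrix (Fin L) (Fin L) ℝ
  isGenerator : MMPPQueue.IsGenerator Q
  irreducible : MMPPQueue.IsIrreducible Q
  /-- arrival rates -/
  lam : Fin L → ℝ
  lam_nonneg : ∀ s, 0 ≤ lam s
  /-- maximum available service rate -/
  ubar : ℝ
  ubar_nonneg : 0 ≤ ubar
  /-- service cost rate, a function on `[0, ubar]` -/
  c : ℝ → ℝ
  c_strictConvex : StrictConvexOn ℝ (Set.Icc 0 ubar) c
  c_contDiff : ContDiffOn ℝ 1 c (Set.Icc 0 ubar)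
  c_strictMono : StrictMonoOn c (Set.Icc 0 ubar)
  c_zero : c 0 = 0
  /-- holding cost rate -/
  h : ℕ → ℝ
  h_mono : Monotone h
  h_convex : ∀ n, h (n + 1) - h n ≤ h (n + 2) - h (n + 1)
  h_zero : h 0 = 0
  h_tendsto : Tendsto h atTop atTop
  h_poly : ∃ (C : ℝ) (k : ℕ), 0 ≤ C ∧ ∀ n, h n ≤ C * (n : ℝ) ^ k

namespace MMPPQueue

variable {L : ℕ}

/-- A state `(n, s)`: number of jobs in the system and phase of the arrival process. -/
abbrev State (L : ℕ) : Type := ℕ × Fin L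

/-- A stationary policy: the service rate `rate n s ∈ [0, ubar]` used in state `(n, s)`; the server
idles when the system is empty. -/
structure Policy (M : MMPPQueue L) where
  rate : ℕ → Fin L → ℝ
  rate_mem : ∀ n s, rate n s ∈ Set.Icc 0 M.ubar
  rate_zero : ∀ s, rate 0 s = 0

/-- The policy that uses the constant rate `m` whenever the queue is non-empty. -/
def constantPolicy (M : MMPPQueue L) (m : ℝ) (hm : m ∈ Set.Icc 0 M.ubar) : M.Policy where
  rate n _ := if n = 0 then 0 else m
  rate_mem n _ := by
    split_ifs
    · exact ⟨le_rfl, M.ubar_nonneg⟩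
    · exact hm
  rate_zero _ := by simp

/-- The generator of the continuous-time Markov chain on `State L` induced by a stationary policy:
`(n, s) → (n + 1, s)` at rate `lam s`, `(n, s) → (n - 1, s)` at rate `rate n s`, and
`(n, s) → (n, r)` at rate `Q s r`, with minus the total rate on the diagonal. -/
def gen (M : MMPPQueue L) (π : M.Policy) (x y : State L) : ℝ :=
  (if y.1 = x.1 then M.Q x.2 y.2 else 0) +
  (if y.2 = x.2 then
    M.lam x.2 * ((if y.1 = x.1 + 1 then 1 else 0) - (if y.1 = x.1 then 1 else 0)) +
    π.rate x.1 x.2 * ((if y.1 + 1 = x.1 then 1 else 0) - (if y.1 = x.1 then 1 else 0))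
  else 0)

/-- A uniformization rate: it bounds the total transition rate out of every state under every
policy. -/
def unifRate (M : MMPPQueue L) : ℝ := ∑ s, M.lam s + ∑ s, -M.Q s s + M.ubar

/-- Transition matrix `I + gen / unifRate` of the uniformized discrete-time chain. -/
def stepProb (M : MMPPQueue L) (π : M.Policy) (x y : State L) : ℝ :=
  (if y = x then 1 else 0) + M.gen π x y / M.unifRate

lemma diag_nonpos (M : MMPPQueue L) (s : Fin L) : 0 ≤ -M.Q s s := by
  have h := M.isGenerator.row_sum s
  rw [← Finset.add_sum_erase _ _ (Finset.mem_univ s)] at h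
  have : 0 ≤ ∑ r ∈ Finset.univ.erase s, M.Q s r :=
    Finset.sum_nonneg fun r hr => M.isGenerator.offDiag_nonneg s r (Finset.ne_of_mem_erase hr).symm
  linarith

lemma unifRate_nonneg (M : MMPPQueue L) : 0 ≤ M.unifRate :=
  add_nonneg (add_nonneg (Finset.sum_nonneg fun s _ => M.lam_nonneg s)
    (Finset.sum_nonneg fun s _ => M.diag_nonpos s)) M.ubar_nonneg

lemma exitRate_le (M : MMPPQueue L) (π : M.Policy) (n : ℕ) (s : Fin L) :
    M.lam s + -M.Q s s + π.rate n s ≤ M.unifRate :=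
  add_le_add (add_le_add
    (Finset.single_le_sum (f := M.lam) (fun r _ => M.lam_nonneg r) (Finset.mem_univ s))
    (Finset.single_le_sum (f := fun r => -M.Q r r) (fun r _ => M.diag_nonpos r)
      (Finset.mem_univ s))) (π.rate_mem n s).2

lemma stepProb_nonneg (M : MMPPQueue L) (π : M.Policy) (x y : State L) :
    0 ≤ M.stepProb π x y := by
  obtain ⟨n, s⟩ := x
  obtain ⟨m, r⟩ := y
  have hν := M.unifRate_nonneg
  have hl := M.lam_nonneg s
  have hr := (π.rate_mem n s).1
  by_cases hxy : (m, r) = (n, s)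
  · obtain ⟨rfl, rfl⟩ := Prod.mk.inj hxy
    have h1 := M.exitRate_le π m r
    have h2 : M.gen π (m, r) (m, r) = -(M.lam r + -M.Q r r + π.rate m r) := by
      simp [gen]; ring
    rw [stepProb, h2, if_pos rfl, neg_div]
    have := div_le_one_of_le₀ h1 hν
    linarith
  · rw [stepProb, if_neg hxy, zero_add]
    refine div_nonneg ?_ hν
    unfold gen
    by_cases h1 : m = n
    · subst h1
      have h2 : r ≠ s := fun h => hxy (by rw [h])
      simpa [h2] using M.isGenerator.offDiag_nonneg s r h2.symm
    · simp only [h1, if_false, zero_add, sub_zero]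
      split_ifs <;> simp <;> linarith

lemma stepProb_eq_zero (M : MMPPQueue L) (π : M.Policy) (x y : State L)
    (hy : y ∉ Finset.Icc (x.1 - 1) (x.1 + 1) ×ˢ (Finset.univ : Finset (Fin L))) :
    M.stepProb π x y = 0 := by
  simp only [Finset.mem_product, Finset.mem_Icc, Finset.mem_univ, and_true] at hy
  have h1 : y.1 ≠ x.1 := by omega
  have h2 : y.1 ≠ x.1 + 1 := by omega
  have h3 : y.1 + 1 ≠ x.1 := by omega
  have h4 : y ≠ x := fun h => h1 (by rw [h])
  simp [stepProb, gen, h1, h2, h3, h4]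

lemma sum_gen (M : MMPPQueue L) (π : M.Policy) (x : State L) :
    ∑ y ∈ Finset.Icc (x.1 - 1) (x.1 + 1) ×ˢ (Finset.univ : Finset (Fin L)), M.gen π x y = 0 := by
  obtain ⟨n, s⟩ := x
  rw [Finset.sum_product]
  simp only [gen, Finset.sum_add_distrib, Finset.sum_ite_eq', Finset.mem_univ, if_true]
  have h1 : ∀ m : ℕ, ∑ r, (if m = n then M.Q s r else 0) = 0 := fun m => by
    split_ifs
    · exact M.isGenerator.row_sum s
    · simp
  simp only [h1, Finset.sum_const_zero, zero_add, ← Finset.mul_sum, Finset.sum_sub_distrib,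
    Finset.sum_ite_eq']
  rcases n with _ | n
  · simp [π.rate_zero]
  · have h2 : n ≤ n + 1 + 1 := by omega
    simp [h2]

lemma sum_stepProb (M : MMPPQueue L) (π : M.Policy) (x : State L) :
    ∑ y ∈ Finset.Icc (x.1 - 1) (x.1 + 1) ×ˢ (Finset.univ : Finset (Fin L)),
      M.stepProb π x y = 1 := by
  simp only [stepProb, Finset.sum_add_distrib, ← Finset.sum_div, sum_gen, zero_div, add_zero,
    Finset.sum_ite_eq']
  simp

/-- One step of the uniformized chain. -/
def step (M : MMPPQueue L) (π : M.Policy) (x : State L) : PMF (State L) :=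
  PMF.ofFinset (fun y => ENNReal.ofReal (M.stepProb π x y))
    (Finset.Icc (x.1 - 1) (x.1 + 1) ×ˢ (Finset.univ : Finset (Fin L)))
    (by rw [← ENNReal.ofReal_sum_of_nonneg fun y _ => M.stepProb_nonneg π x y, M.sum_stepProb,
      ENNReal.ofReal_one])
    (fun y hy => by rw [M.stepProb_eq_zero π x y hy, ENNReal.ofReal_zero])

/-- Law of the uniformized chain after `k` steps from `x`. -/
def chain (M : MMPPQueue L) (π : M.Policy) : ℕ → State L → PMF (State L)
  | 0, x => PMF.pure x
  | k + 1, x => (M.step π x).bind (chain M π k)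

/-- Law of the state `X(t)` of the continuous-time Markov chain with generator `gen` started at
`x`, for `t ≥ 0`.  The generator is bounded, so the transition function `exp (t • gen)` is that of
the uniformized chain run at the events of a Poisson process of rate `unifRate`. -/
def law (M : MMPPQueue L) (π : M.Policy) (t : ℝ) (x : State L) : PMF (State L) :=
  (poissonMeasure (M.unifRate * t).toNNReal).toPMF.bind fun k => M.chain π k x

/-- The system is stable under `π`: a steady-state (stationary) distribution of the induced
continuous-time Markov chain exists. -/
def Stable (M : MMPPQueue L) (π : M.Policy) : Prop :=
  ∃ q : PMF (State L), ∀ t : ℝ, 0 ≤ t → q.bind (M.law π t) = q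

/-- Cost rate `f(x, π(x)) = c(π(x)) + h(n)` in state `x = (n, s)`; it is nonnegative. -/
def costRate (M : MMPPQueue L) (π : M.Policy) (x : State L) : ℝ :=
  M.c (π.rate x.1 x.2) + M.h x.1

/-- Expected (undiscounted) cost `E_x ∫₀ᵗ f(X(u), D(u)) du` until time `t` from initial state `x`,
in `[0, ∞]`. -/
def totalCost (M : MMPPQueue L) (π : M.Policy) (t : ℝ) (x : State L) : ℝ≥0∞ :=
  ∫⁻ u in Set.Ioc 0 t, ∑' y, M.law π u x y * ENNReal.ofReal (M.costRate π y)

/-- Long-run average cost (gain) of the policy `π` from initial state `x`, in `[0, ∞]`. -/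
def gain (M : MMPPQueue L) (π : M.Policy) (x : State L) : ℝ≥0∞ :=
  limsup (fun t : ℝ => M.totalCost π t x / ENNReal.ofReal t) atTop

end MMPPQueue

end

/-! Everything is reduced to the uniformized discrete-time chain with one-step operator `T =
stepOp`. Laws at time `t` are Poisson mixtures of the powers of `T`, so limits of `T ^ k` become
limits in continuous time. Write `ρ` for the mean arrival rate. The phases are averaged out by a
solution `y` of the Poisson equation `Q y = ρ - lam`: adding `y s` to the queue length replaces the
arrival rate of the current phase by `ρ` in the drift.

Necessity. A stationary law of the continuous-time chain is invariant under one uniformized step, as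
the derivative at time zero of the Poisson mixtures shows (`bind_step_of_bind_law`). Testing
invariance on `y s + min n N` and letting `N` grow gives `ρ ≤ ubar` (`mean_arrival_le`). The
inequality is strict because the lowest occupied level contains a state of positive mass in which no
service takes place (`exists_rate_eq_zero`).

Sufficiency. For a constant rate `m > ρ`, the relative drift of `V = exp (θ (n + y s))` vanishes at
`θ = 0` with derivative `ρ - m < 0`, so a small `θ` yields a geometric drift condition
(`exists_geometric_drift`). An empty state has a positive holding probability and is reachable from
everywhere, and sublevel sets of `V` are finite. Harris' theorem (`exists_tendsto_pow`) then makes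
`T ^ k φ` converge to a constant for every `φ` dominated by `1 + V`. Indicators of points produce
the stationary law, with no mass lost because of the drift (`hasSum_one_of_tendsto_pow`). The cost
rate grows polynomially, hence is dominated too, and its limit is the gain (`gain_eq_of_tendsto`).
-/

/-! ### Markov operators and Harris' theorem -/

/-- A positive linear operator on real functions which preserves constants. -/
structure IsMarkovOperator {X : Type*} (T : (X → ℝ) →ₗ[ℝ] (X → ℝ)) : Prop where
  mono : Monotone T
  map_one : T 1 = 1

namespace IsMarkovOperator

variable {X : Type*} {T : (X → ℝ) →ₗ[ℝ] (X → ℝ)}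

lemma pow (hT : IsMarkovOperator T) (n : ℕ) : IsMarkovOperator (T ^ n) := by
  induction n with
  | zero => exact ⟨fun _ _ h => h, rfl⟩
  | succ n ih =>
    refine ⟨fun φ ψ h => ?_, ?_⟩
    · rw [pow_succ]; exact ih.mono (hT.mono h)
    · rw [pow_succ, Module.End.mul_apply, hT.map_one, ih.map_one]

/-- Integration against a kernel enters the estimates below mainly through pointwise bounds affine
in two functions, typically `V` and the indicator of the atom. -/
lemma map_affine (hT : IsMarkovOperator T) (a b c : ℝ) (f g : X → ℝ) (x : X) :
    T (fun u => a + b * f u + c * g u) x = a + b * T f x + c * T g x := by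
  have : (fun u => a + b * f u + c * g u) = a • (1 : X → ℝ) + b • f + c • g := by
    ext u; simp
  rw [this, map_add, map_add, map_smul, map_smul, map_smul, hT.map_one]
  simp

lemma le_affine (hT : IsMarkovOperator T) {a b c : ℝ} {φ f g : X → ℝ}
    (h : ∀ u, φ u ≤ a + b * f u + c * g u) (x : X) : T φ x ≤ a + b * T f x + c * T g x := by
  rw [← hT.map_affine]
  exact hT.mono (fun u => h u) x

lemma affine_le (hT : IsMarkovOperator T) {a b c : ℝ} {φ f g : X → ℝ}
    (h : ∀ u, a + b * f u + c * g u ≤ φ u) (x : X) : a + b * T f x + c * T g x ≤ T φ x := by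
  rw [← hT.map_affine]
  exact hT.mono (fun u => h u) x

lemma nonneg (hT : IsMarkovOperator T) {φ : X → ℝ} (h : ∀ u, 0 ≤ φ u) (x : X) : 0 ≤ T φ x := by
  simpa using hT.affine_le (a := 0) (b := 0) (c := 0) (f := φ) (g := φ) (by simpa using h) x

/-- The additive term is the fixed point of `t ↦ γ * t + K`, so it is reproduced exactly by the
induction and bounds all iterates at once. -/
lemma pow_drift (hT : IsMarkovOperator T) {V : X → ℝ} {γ K : ℝ} (hγ0 : 0 ≤ γ) (hγ1 : γ < 1)
    (hK : 0 ≤ K) (hd : ∀ x, T V x ≤ γ * V x + K) (k : ℕ) (x : X) :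
    (T ^ k) V x ≤ γ ^ k * V x + K / (1 - γ) := by
  have h1 : 0 < 1 - γ := by linarith
  induction k generalizing x with
  | zero => simpa using div_nonneg hK h1.le
  | succ k ih =>
    rw [pow_succ, Module.End.mul_apply]
    have h2 := (hT.pow k).le_affine (φ := T V) (a := K) (b := γ) (c := 0) (f := V) (g := V)
      (fun u => by linarith [hd u]) x
    have h3 := mul_le_mul_of_nonneg_left (ih x) hγ0
    have h4 : K / (1 - γ) = γ * (K / (1 - γ)) + K := by field_simp; ring
    rw [pow_succ]
    linarith

/-- The contraction step in the proof of Harris' theorem: a Markov operator with a geometric drift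
condition and a common atom on a large sublevel set contracts a weighted oscillation. -/
lemma exists_contraction (hT : IsMarkovOperator T) {V : X → ℝ} (hV : ∀ x, 0 ≤ V x) {γ K a : ℝ}
    (hγ1 : γ < 1) (hK : 0 < K) (hd : ∀ x, T V x ≤ γ * V x + K) (z : X) (ha : 0 < a)
    (hz : ∀ x, V x ≤ 4 * K / (1 - γ) → a ≤ T (Set.indicator {z} 1) x) :
    ∃ β α : ℝ, 0 < β ∧ 0 < α ∧ α < 1 ∧ ∀ (φ : X → ℝ) (c : ℝ), 0 ≤ c →
      (∀ u w, φ u - φ w ≤ c * (2 + β * V u + β * V w)) →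
      ∀ u w, T φ u - T φ w ≤ α * c * (2 + β * V u + β * V w) := by
  set e : X → ℝ := Set.indicator {z} 1 with he
  have he0 : ∀ u, 0 ≤ e u := fun u => Set.indicator_nonneg (by simp) u
  have h1γ : 0 < 1 - γ := by linarith
  set b := min a 1 with hb
  have hb0 : 0 < b := lt_min ha one_pos
  have hb1 : b ≤ 1 := min_le_right _ _
  -- With this weight the drift excess `2βK` equals `b ^ 2`, half of the `2 * b ^ 2` that is won
  -- when both copies hit the atom.
  set β := b ^ 2 / (2 * K) with hβ
  have hβ0 : 0 < β := by positivity
  have hβK : 2 * (β * K) = b ^ 2 := by rw [hβ]; field_simp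
  set R := 4 * K / (1 - γ) with hR
  have hR0 : 0 < R := by positivity
  have hRK : (1 - γ) * R = 4 * K := by rw [hR]; field_simp
  -- Beyond `R` the constant is absorbed in a slightly worse rate: `(γ' - γ) * R = 2 * K`.
  set γ' := (1 + γ) / 2 with hγ'
  set α₁ := (2 + β * γ' * R) / (2 + β * R) with hα₁
  have hden : 0 < 2 + β * R := by positivity
  have hα₁1 : α₁ < 1 := by
    rw [hα₁, div_lt_one hden]
    have : 0 < β * R * (1 - γ') := by
      have : 0 < 1 - γ' := by rw [hγ']; linarith
      positivity
    linarith
  -- `α₁` serves pairs with `V x + V y ≥ R`. For the other pairs, `1 - b ^ 2 / 2` contracts the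
  -- constant 2 and `γ` the part with `V`.
  set α := max α₁ (max (1 - b ^ 2 / 2) γ) with hα
  have hb2 : b ^ 2 ≤ 1 := pow_le_one₀ hb0.le hb1
  have hα0 : 0 < α := lt_of_lt_of_le (by linarith) ((le_max_left _ _).trans (le_max_right α₁ _))
  refine ⟨β, α, hβ0, hα0, ?_, ?_⟩
  · have : 0 < b ^ 2 := by positivity
    exact max_lt hα₁1 (max_lt (by linarith) hγ1)
  intro φ c hc hφ x y
  -- At the pair `(z, z)` the left side is zero, so the oscillation bound can be lowered there by `2
  -- * c`.
  have key : ∀ u w, φ u - φ w ≤ c * (2 + β * V u + β * V w) - 2 * c * (e u * e w) := by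
    intro u w
    by_cases h : u = z ∧ w = z
    · obtain ⟨rfl, rfl⟩ := h
      have : 0 ≤ c * (β * V w) := mul_nonneg hc (mul_nonneg hβ0.le (hV w))
      simp only [he, Set.mem_singleton_iff, Set.indicator_of_mem, Pi.one_apply]
      linarith
    · have : e u * e w = 0 := by
        rcases not_and_or.1 h with h | h <;> simp [he, h]
      rw [this]
      linarith [hφ u w]
  -- Independent coupling: `key` is integrated in `u` from `x`, then in `w` from `y`, which turns `e
  -- u * e w` into `T e x * T e y`.
  have s1 : ∀ w, T φ x ≤ (φ w + c * (2 + β * V w)) + c * β * T V x + (-2 * c * e w) * T e x :=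
    fun w => hT.le_affine (fun u => by linarith [key u w]) x
  have s2 := hT.affine_le (φ := φ) (a := T φ x - 2 * c - c * β * T V x) (b := -c * β)
    (c := 2 * c * T e x) (f := V) (g := e) (fun w => by linarith [s1 w]) y
  have s3 : T φ x - T φ y ≤ c * (2 + β * (T V x + T V y) - 2 * (T e x * T e y)) := by linarith
  have s4 : β * (T V x + T V y) ≤ β * (γ * (V x + V y) + 2 * K) :=
    mul_le_mul_of_nonneg_left (by linarith [hd x, hd y]) hβ0.le
  have he1 := hT.nonneg he0
  have s5 : 2 + β * (T V x + T V y) - 2 * (T e x * T e y) ≤ α * (2 + β * V x + β * V y) := by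
    have hS0 : 0 ≤ V x + V y := add_nonneg (hV x) (hV y)
    rcases le_total R (V x + V y) with hS | hS
    · have t1 : 0 ≤ T e x * T e y := mul_nonneg (he1 x) (he1 y)
      have t2 : 2 + β * (γ * (V x + V y) + 2 * K) ≤ 2 + β * γ' * (V x + V y) := by
        have : (1 - γ) * R ≤ (1 - γ) * (V x + V y) := mul_le_mul_of_nonneg_left hS h1γ.le
        have := mul_le_mul_of_nonneg_left (this.trans' hRK.ge) hβ0.le
        rw [hγ']
        linarith
      -- The ratio `(2 + β * γ' * S) / (2 + β * S)` decreases in `S`, so its value `α₁` at `S = R`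
      -- bounds it for all larger `S`.
      have t3 : 2 + β * γ' * (V x + V y) ≤ α₁ * (2 + β * (V x + V y)) := by
        rw [hα₁, div_mul_eq_mul_div (2 + β * γ' * R) (2 + β * R) (2 + β * (V x + V y)),
          le_div_iff₀ hden]
        have : 0 ≤ β * (1 - γ') * (V x + V y - R) := by
          have : 0 ≤ 1 - γ' := by rw [hγ']; linarith
          have : 0 ≤ V x + V y - R := by linarith
          positivity
        linarith
      have t4 : α₁ * (2 + β * (V x + V y)) ≤ α * (2 + β * (V x + V y)) :=
        mul_le_mul_of_nonneg_right (le_max_left _ _) (by positivity)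
      linarith
    · have t1 : ∀ v, V v ≤ R → b ≤ T e v := fun v hv => (min_le_left _ _).trans (hz v hv)
      have tx := t1 x (by linarith [hV y])
      have ty := t1 y (by linarith [hV x])
      have t2 : b * b ≤ T e x * T e y := mul_le_mul tx ty hb0.le (hb0.le.trans tx)
      have t3 : (1 - b ^ 2 / 2) * 2 ≤ α * 2 :=
        mul_le_mul_of_nonneg_right ((le_max_left _ _).trans (le_max_right _ _)) (by norm_num)
      have t4 : γ * (β * (V x + V y)) ≤ α * (β * (V x + V y)) :=
        mul_le_mul_of_nonneg_right ((le_max_right _ _).trans (le_max_right _ _)) (by positivity)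
      linarith
  calc T φ x - T φ y ≤ _ := s3
    _ ≤ c * (α * (2 + β * V x + β * V y)) := mul_le_mul_of_nonneg_left s5 hc
    _ = _ := by ring

/-- Harris' theorem: under a geometric drift condition and a minorization on sublevel sets, the
iterates of a function dominated by the Lyapunov function converge to a constant. -/
lemma exists_tendsto_pow (hT : IsMarkovOperator T) {V : X → ℝ} (hV : ∀ x, 0 ≤ V x) {γ K : ℝ}
    (hγ0 : 0 ≤ γ) (hγ1 : γ < 1) (hK : 0 < K) (hd : ∀ x, T V x ≤ γ * V x + K) (z : X)
    (hz : ∀ R, ∃ N : ℕ, 0 < N ∧ ∃ a : ℝ, 0 < a ∧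
      ∀ x, V x ≤ R → a ≤ (T ^ N) (Set.indicator {z} 1) x)
    {φ : X → ℝ} {C : ℝ} (hφ : ∀ x, |φ x| ≤ C * (1 + V x)) :
    ∃ l : ℝ, ∀ x, Tendsto (fun k => (T ^ k) φ x) atTop (nhds l) := by
  have h1γ : 0 < 1 - γ := by linarith
  set K' := K / (1 - γ) with hK'
  have hK'0 : 0 < K' := by positivity
  have hdk : ∀ k x, (T ^ k) V x ≤ V x + K' := fun k x =>
    (hT.pow_drift hγ0 hγ1 hK.le hd k x).trans
      (by linarith [mul_le_of_le_one_left (hV x) (pow_le_one₀ (n := k) hγ0 hγ1.le)])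
  -- The contraction is applied to `T ^ N`, whose drift has constant `K'`. As `K'` does not depend
  -- on `N`, the radius can be fixed before `N` is known.
  obtain ⟨N, hN, a, ha, hza⟩ := hz (4 * K' / (1 - γ))
  have hdN : ∀ x, (T ^ N) V x ≤ γ * V x + K' := fun x =>
    (hT.pow_drift hγ0 hγ1 hK.le hd N x).trans
      (by
        have : γ ^ N ≤ γ := pow_le_of_le_one hγ0 hγ1.le hN.ne'
        linarith [mul_le_mul_of_nonneg_right this (hV x)])
  obtain ⟨β, α, hβ, hα0, hα1, hcon⟩ :=
    (hT.pow N).exists_contraction hV hγ1 hK'0 hdN z ha hza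
  have hC : 0 ≤ C := by
    have := (abs_nonneg _).trans (hφ z)
    exact nonneg_of_mul_nonneg_left this (by linarith [hV z])
  obtain ⟨c, hc, hφc⟩ : ∃ c, 0 ≤ c ∧ ∀ u w, φ u - φ w ≤ c * (2 + β * V u + β * V w) := by
    refine ⟨C * (1 + 1 / β), by positivity, fun u w => ?_⟩
    have h1 := (abs_le.1 (hφ u)).2
    have h2 := (abs_le.1 (hφ w)).1
    have h3 : C * (1 + 1 / β) * (2 + β * V u + β * V w) =
      C * (2 + V u + V w) + C * (β * V u + β * V w + 2 * (1 / β)) := by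
      field_simp; ring
    have h4 : 0 ≤ C * (β * V u + β * V w + 2 * (1 / β)) := by
      have := hV u
      have := hV w
      positivity
    linarith
  have hskel : ∀ j u w, (T ^ (N * j)) φ u - (T ^ (N * j)) φ w ≤
      α ^ j * c * (2 + β * V u + β * V w) := by
    intro j
    induction j with
    | zero => simpa using hφc
    | succ j ih =>
      intro u w
      have := hcon _ (α ^ j * c) (by positivity) ih u w
      rw [mul_add, mul_one, add_comm, pow_add, Module.End.mul_apply, pow_succ]
      linarith
  set c' := c * (1 + β * K') with hc'
  have hc'0 : 0 ≤ c' := by positivity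
  -- The remaining `k % N` steps are applied to the contracted function; by the uniform bound on
  -- iterates of `V` they cost only the factor `1 + β * K'`.
  have hosc : ∀ k u w, (T ^ k) φ u - (T ^ k) φ w ≤
      α ^ (k / N) * c' * (2 + β * V u + β * V w) := by
    intro k u w
    have hk : T ^ k = T ^ (k % N) * T ^ (N * (k / N)) := by rw [← pow_add, Nat.mod_add_div]
    rw [hk, Module.End.mul_apply]
    set ψ := (T ^ (N * (k / N))) φ
    set d := α ^ (k / N) * c
    have hd0 : 0 ≤ d := by positivity
    have hM := hT.pow (k % N)
    have s1 : ∀ y, (T ^ (k % N)) ψ u ≤ (ψ y + d * (2 + β * V y)) + d * β * (T ^ (k % N)) V u +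
        0 * (T ^ (k % N)) V u :=
      fun y => hM.le_affine (fun x => by linarith [hskel (k / N) x y]) u
    have s2 := hM.affine_le (φ := ψ) (a := (T ^ (k % N)) ψ u - 2 * d -
      d * β * (T ^ (k % N)) V u) (b := -d * β) (c := 0) (f := V) (g := V)
      (fun y => by linarith [s1 y]) w
    have s3 : d * β * ((T ^ (k % N)) V u + (T ^ (k % N)) V w) ≤
        d * β * (V u + V w + 2 * K') :=
      mul_le_mul_of_nonneg_left (by linarith [hdk (k % N) u, hdk (k % N) w]) (by positivity)
    have s4 : α ^ (k / N) * c' * (2 + β * V u + β * V w) =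
        d * (2 + β * (V u + V w + 2 * K')) + d * (β * K') * (β * V u + β * V w) := by
      simp only [d, hc']; ring
    have s5 : 0 ≤ d * (β * K') * (β * V u + β * V w) := by
      have := hV u
      have := hV w
      positivity
    linarith
  -- One more step averages the differences from the value at `x`, so oscillation decay controls
  -- successive iterates and makes them Cauchy.
  have hstep : ∀ x k, |(T ^ (k + 1)) φ x - (T ^ k) φ x| ≤
      α ^ (k / N) * (c' * (2 + β * (2 * V x + K'))) := by
    intro x k
    rw [pow_succ', Module.End.mul_apply]
    set ψ := (T ^ k) φ
    set d := α ^ (k / N) * c'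
    have hd0 : 0 ≤ d := by positivity
    have s1 := hT.le_affine (φ := ψ) (a := ψ x + d * (2 + β * V x)) (b := d * β) (c := 0) (f := V)
      (g := V) (fun u => by linarith [hosc k u x]) x
    have s2 := hT.affine_le (φ := ψ) (a := ψ x - d * (2 + β * V x)) (b := -d * β) (c := 0) (f := V)
      (g := V) (fun u => by linarith [hosc k x u]) x
    have s3 : d * β * T V x ≤ d * β * (V x + K') :=
      mul_le_mul_of_nonneg_left (by simpa using hdk 1 x) (by positivity)
    have s4 : α ^ (k / N) * (c' * (2 + β * (2 * V x + K'))) = d * (2 + β * (2 * V x + K')) := by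
      ring
    rw [s4, abs_le]
    constructor <;> linarith
  obtain ⟨r, hr0, hr1, hrN⟩ : ∃ r : ℝ, 0 < r ∧ r < 1 ∧ r ^ N = α :=
    ⟨α ^ ((N : ℝ)⁻¹), Real.rpow_pos_of_pos hα0 _, Real.rpow_lt_one hα0.le hα1 (by positivity),
      Real.rpow_inv_natCast_pow hα0.le hN.ne'⟩
  have hgeo : ∀ k : ℕ, α ^ (k / N) ≤ α⁻¹ * r ^ k := by
    intro k
    rw [le_inv_mul_iff₀ hα0, ← pow_succ', ← hrN, ← pow_mul]
    apply pow_le_pow_of_le_one hr0.le hr1.le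
    have := Nat.lt_mul_div_succ k hN
    linarith
  have hzero : Tendsto (fun k : ℕ => α ^ (k / N)) atTop (nhds 0) := by
    refine squeeze_zero (fun k => by positivity) hgeo ?_
    simpa using (tendsto_pow_atTop_nhds_zero_of_lt_one hr0.le hr1).const_mul α⁻¹
  have hlim : ∀ x, ∃ l, Tendsto (fun k => (T ^ k) φ x) atTop (nhds l) := by
    intro x
    apply cauchySeq_tendsto_of_complete
    refine cauchySeq_of_le_geometric r (α⁻¹ * (c' * (2 + β * (2 * V x + K')))) hr1 fun k => ?_
    rw [dist_comm, Real.dist_eq]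
    refine (hstep x k).trans ?_
    have h0 : 0 ≤ c' * (2 + β * (2 * V x + K')) := by have := hV x; positivity
    linarith [mul_le_mul_of_nonneg_right (hgeo k) h0]
  obtain ⟨l, hl⟩ := hlim z
  refine ⟨l, fun x => ?_⟩
  have hz0 : Tendsto (fun k => (T ^ k) φ x - (T ^ k) φ z) atTop (nhds 0) := by
    have hb : Tendsto (fun k : ℕ => α ^ (k / N) * (c' * (2 + β * V x + β * V z))) atTop
        (nhds 0) := by simpa using hzero.mul_const (c' * (2 + β * V x + β * V z))
    refine squeeze_zero_norm (fun k => ?_) hb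
    rw [Real.norm_eq_abs, abs_le]
    constructor <;> linarith [hosc k x z, hosc k z x]
  simpa using hz0.add hl

/-- A drift condition with finite sublevel sets makes the iterates tight, so that the limits of the
point probabilities sum to one. -/
lemma hasSum_one_of_tendsto_pow (hT : IsMarkovOperator T) {V : X → ℝ} (hV : ∀ x, 0 ≤ V x)
    {γ K : ℝ} (hγ0 : 0 ≤ γ) (hγ1 : γ < 1) (hK : 0 < K) (hd : ∀ x, T V x ≤ γ * V x + K)
    (hfin : ∀ R, {x | V x ≤ R}.Finite) {l : X → ℝ} (x₀ : X)
    (hl : ∀ y, Tendsto (fun k => (T ^ k) (Set.indicator {y} 1) x₀) atTop (nhds (l y))) :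
    (∀ y, 0 ≤ l y) ∧ HasSum l 1 := by
  classical
  have he0 : ∀ y u : X, 0 ≤ Set.indicator {y} (1 : X → ℝ) u :=
    fun y u => Set.indicator_nonneg (by simp) u
  have hl0 : ∀ y, 0 ≤ l y := fun y =>
    ge_of_tendsto' (hl y) fun k => (hT.pow k).nonneg (he0 y) x₀
  have hsumF : ∀ F : Finset X, Tendsto (fun k => (T ^ k) (Set.indicator (F : Set X) 1) x₀) atTop
      (nhds (∑ y ∈ F, l y)) := by
    intro F
    have h1 : Set.indicator (F : Set X) (1 : X → ℝ) = ∑ y ∈ F, Set.indicator {y} 1 := by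
      ext u
      simp [Finset.sum_apply, Set.indicator_apply]
    simp only [h1, map_sum, Finset.sum_apply]
    exact tendsto_finsetSum _ fun y _ => hl y
  have hF1 : ∀ F : Finset X, ∑ y ∈ F, l y ≤ 1 := fun F => by
    refine le_of_tendsto' (hsumF F) fun k => ?_
    have := (hT.pow k).mono (show Set.indicator (F : Set X) (1 : X → ℝ) ≤ 1 from
      Set.indicator_le_self' (by simp)) x₀
    simpa [(hT.pow k).map_one] using this
  set B := V x₀ + K / (1 - γ) with hB
  have hBk : ∀ k, (T ^ k) V x₀ ≤ B := fun k =>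
    (hT.pow_drift hγ0 hγ1 hK.le hd k x₀).trans
      (by linarith [mul_le_of_le_one_left (hV x₀) (pow_le_one₀ (n := k) hγ0 hγ1.le)])
  -- Markov's inequality in the form `1 - V / R ≤ 1_{V ≤ R}`, uniformly in `k`.
  have hFR : ∀ R : ℝ, 0 < R → 1 - B / R ≤ ∑ y ∈ (hfin R).toFinset, l y := by
    intro R hR
    refine ge_of_tendsto' (hsumF _) fun k => ?_
    have h1 := (hT.pow k).affine_le (φ := Set.indicator ((hfin R).toFinset : Set X) 1) (a := 1)
      (b := -R⁻¹) (c := 0) (f := V) (g := V) (fun u => by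
        by_cases hu : V u ≤ R
        · have : 0 ≤ R⁻¹ * V u := mul_nonneg (by positivity) (hV u)
          simp [hu]
          linarith
        · have : 1 ≤ R⁻¹ * V u := by
            rw [inv_mul_eq_div, one_le_div hR]; linarith
          simp [hu]
          linarith) x₀
    have h2 : R⁻¹ * (T ^ k) V x₀ ≤ B / R := by
      rw [inv_mul_eq_div]
      exact div_le_div_of_nonneg_right (hBk k) hR.le
    linarith
  refine ⟨hl0, ?_⟩
  apply hasSum_of_isLUB_of_nonneg _ hl0
  refine ⟨?_, fun b hb => ?_⟩
  · rintro _ ⟨F, rfl⟩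
    exact hF1 F
  · have ht : Tendsto (fun R : ℝ => 1 - B / R) atTop (nhds (1 - 0)) :=
      tendsto_const_nhds.sub (tendsto_id.const_div_atTop B)
    rw [sub_zero] at ht
    refine le_of_tendsto ht ?_
    filter_upwards [eventually_gt_atTop 0] with R hR
    exact (hFR R hR).trans (hb ⟨_, rfl⟩)

end IsMarkovOperator

/-! ### The one-step operator of the uniformized chain -/

namespace MMPPQueue

variable {L : ℕ}

/-- The finite set of states that contains every state reachable from `x` in one step. -/
def nbhd (x : State L) : Finset (State L) := Finset.Icc (x.1 - 1) (x.1 + 1) ×ˢ Finset.univ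

/-- The one-step operator `φ ↦ (x ↦ E φ(X₁))` of the uniformized chain. -/
noncomputable def stepOp (M : MMPPQueue L) (π : M.Policy) : (State L → ℝ) →ₗ[ℝ] (State L → ℝ) where
  toFun φ x := ∑ y ∈ nbhd x, M.stepProb π x y * φ y
  map_add' φ ψ := by ext x; simp [mul_add, Finset.sum_add_distrib]
  map_smul' c φ := by
    ext x
    simp only [Pi.smul_apply, smul_eq_mul, RingHom.id_apply, Finset.mul_sum]
    exact Finset.sum_congr rfl fun y _ => by ring

lemma stepOp_apply (M : MMPPQueue L) (π : M.Policy) (φ : State L → ℝ) (x : State L) :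
    M.stepOp π φ x = ∑ y ∈ nbhd x, M.stepProb π x y * φ y := rfl

lemma isMarkovOperator_stepOp (M : MMPPQueue L) (π : M.Policy) :
    IsMarkovOperator (M.stepOp π) where
  mono φ ψ h x := Finset.sum_le_sum fun y _ =>
    mul_le_mul_of_nonneg_left (h y) (M.stepProb_nonneg π x y)
  map_one := by
    ext x
    simpa [stepOp_apply, nbhd] using M.sum_stepProb π x

lemma mem_nbhd_of_stepProb_ne_zero (M : MMPPQueue L) (π : M.Policy) {x y : State L}
    (h : M.stepProb π x y ≠ 0) : y ∈ nbhd x := by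
  by_contra hy
  exact h (M.stepProb_eq_zero π x y hy)

/-- Drift computations use this generator form. At `n = 0` the truncated `n - 1` is harmless, since
the service rate is zero there. -/
lemma stepOp_eq (M : MMPPQueue L) (π : M.Policy) (φ : State L → ℝ) (n : ℕ) (s : Fin L) :
    M.stepOp π φ (n, s) = φ (n, s) + (∑ r, M.Q s r * φ (n, r) +
      M.lam s * (φ (n + 1, s) - φ (n, s)) +
      π.rate n s * (φ (n - 1, s) - φ (n, s))) / M.unifRate := by
  have hmem : ((n, s) : State L) ∈ nbhd ((n, s) : State L) := by
    simp [nbhd]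
  have h1 : ∑ y ∈ nbhd ((n, s) : State L), (if y = (n, s) then (1 : ℝ) else 0) * φ y
      = φ (n, s) := by
    simp [hmem]
  have h2 : ∑ y ∈ nbhd ((n, s) : State L), M.gen π (n, s) y * φ y =
      ∑ r, M.Q s r * φ (n, r) + M.lam s * (φ (n + 1, s) - φ (n, s)) +
      π.rate n s * (φ (n - 1, s) - φ (n, s)) := by
    rw [nbhd, Finset.sum_product]
    simp only [gen, add_mul, ite_mul, zero_mul, Finset.sum_add_distrib, Finset.sum_ite_eq',
      Finset.mem_univ, if_true, mul_sub, sub_mul, mul_ite, mul_one, mul_zero,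
      Finset.sum_sub_distrib]
    have h3 : ∑ m ∈ Finset.Icc (n - 1) (n + 1), ∑ r, (if m = n then M.Q s r * φ (m, r) else 0)
        = ∑ r, M.Q s r * φ (n, r) := by
      rw [Finset.sum_eq_single n]
      · simp
      · intro b _ hb; simp [hb]
      · intro h; simp at h
    rw [h3]
    rcases n with _ | n
    · simp [π.rate_zero]
    · have h2 : n ≤ n + 1 + 1 := by omega
      simp [h2]
      ring
  simp only [stepOp_apply, stepProb, add_mul, Finset.sum_add_distrib, h1, div_mul_eq_mul_div,
    ← Finset.sum_div, h2]

lemma le_stepOp (M : MMPPQueue L) (π : M.Policy) {φ : State L → ℝ} (hφ : ∀ x, 0 ≤ φ x)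
    (x y : State L) : M.stepProb π x y * φ y ≤ M.stepOp π φ x := by
  by_cases h : M.stepProb π x y = 0
  · rw [h, zero_mul]
    exact (M.isMarkovOperator_stepOp π).nonneg hφ x
  · exact Finset.single_le_sum (f := fun y => M.stepProb π x y * φ y)
      (fun z _ => mul_nonneg (M.stepProb_nonneg π x z) (hφ z))
      (M.mem_nbhd_of_stepProb_ne_zero π h)

lemma tsum_step_mul (M : MMPPQueue L) (π : M.Policy) {φ : State L → ℝ} (hφ : ∀ x, 0 ≤ φ x)
    (x : State L) :
    ∑' y, M.step π x y * ENNReal.ofReal (φ y) = ENNReal.ofReal (M.stepOp π φ x) := by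
  rw [stepOp_apply, ENNReal.ofReal_sum_of_nonneg
    fun y _ => mul_nonneg (M.stepProb_nonneg π x y) (hφ y), tsum_eq_sum (s := nbhd x)]
  · refine Finset.sum_congr rfl fun y _ => ?_
    rw [ENNReal.ofReal_mul (M.stepProb_nonneg π x y), step, PMF.ofFinset_apply]
  · intro y hy
    have : M.stepProb π x y = 0 := M.stepProb_eq_zero π x y hy
    simp [step, PMF.ofFinset_apply, this]

/-- Bridge from `PMF` sums in `[0, ∞]` to powers of a real linear operator, to which Harris' theorem
applies. -/
lemma tsum_chain_mul (M : MMPPQueue L) (π : M.Policy) {φ : State L → ℝ} (hφ : ∀ x, 0 ≤ φ x)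
    (k : ℕ) (x : State L) :
    ∑' y, M.chain π k x y * ENNReal.ofReal (φ y) = ENNReal.ofReal ((M.stepOp π ^ k) φ x) := by
  induction k generalizing x with
  | zero =>
    rw [tsum_eq_single x]
    · simp [chain]
    · intro y hy; simp [chain, hy]
  | succ k ih =>
    simp only [chain, PMF.bind_apply, ← ENNReal.tsum_mul_right]
    rw [ENNReal.tsum_comm]
    simp only [mul_assoc, ENNReal.tsum_mul_left, ih]
    rw [M.tsum_step_mul π fun x => ((M.isMarkovOperator_stepOp π).pow k).nonneg hφ x, pow_succ',
      Module.End.mul_apply]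

lemma tsum_law_mul (M : MMPPQueue L) (π : M.Policy) {φ : State L → ℝ} (hφ : ∀ x, 0 ≤ φ x)
    (t : ℝ) (x : State L) :
    ∑' y, M.law π t x y * ENNReal.ofReal (φ y) =
      ∑' k, (poissonMeasure (M.unifRate * t).toNNReal).toPMF k *
        ENNReal.ofReal ((M.stepOp π ^ k) φ x) := by
  simp only [law, PMF.bind_apply, ← ENNReal.tsum_mul_right]
  rw [ENNReal.tsum_comm]
  simp only [mul_assoc, ENNReal.tsum_mul_left, M.tsum_chain_mul π hφ]

lemma bind_law (M : MMPPQueue L) (π : M.Policy) (q : PMF (State L)) (t : ℝ) :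
    q.bind (M.law π t) = (poissonMeasure (M.unifRate * t).toNNReal).toPMF.bind
      fun k => q.bind (M.chain π k) :=
  PMF.bind_comm _ _ _

lemma stepProb_service (M : MMPPQueue L) (π : M.Policy) (n : ℕ) (s : Fin L) :
    M.stepProb π (n + 1, s) (n, s) = π.rate (n + 1) s / M.unifRate := by
  have : ¬ n = n + 1 + 1 := by omega
  simp [stepProb, gen, this]

/-- A distribution invariant under one step of the uniformized chain is stationary. -/
lemma stable_of_bind_step (M : MMPPQueue L) (π : M.Policy) (q : PMF (State L))
    (hq : q.bind (M.step π) = q) : M.Stable π := by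
  have hk : ∀ k, q.bind (M.chain π k) = q := by
    intro k
    induction k with
    | zero => exact PMF.bind_pure q
    | succ k ih =>
      calc q.bind (M.chain π (k + 1)) = (q.bind (M.step π)).bind (M.chain π k) := by
            rw [PMF.bind_bind]; rfl
        _ = q := by rw [hq, ih]
  refine ⟨q, fun t _ => ?_⟩
  rw [bind_law]
  simp only [hk, PMF.bind_const]

/-- Positive transition probabilities along a path make the target reachable from its start. -/
lemma exists_pow_stepOp_pos (M : MMPPQueue L) (π : M.Policy) {x z : State L}
    (h : Relation.ReflTransGen (fun a b => 0 < M.stepProb π a b) x z) :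
    ∃ N, 0 < (M.stepOp π ^ N) (Set.indicator {z} 1) x := by
  induction h using Relation.ReflTransGen.head_induction_on with
  | refl => exact ⟨0, by simp⟩
  | head hab _ ih =>
    obtain ⟨N, hN⟩ := ih
    refine ⟨N + 1, ?_⟩
    rw [pow_succ', Module.End.mul_apply]
    exact (mul_pos hab hN).trans_le (M.le_stepOp π
      (((M.isMarkovOperator_stepOp π).pow N).nonneg
        fun u => Set.indicator_nonneg (by simp) u) _ _)

/-- Once at `z` the chain may stay there: `T 1_z ≥ stepProb z z * 1_z`. This aperiodicity allows a
common number of steps for finitely many starting points. -/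
lemma pow_stepOp_pos_of_le (M : MMPPQueue L) (π : M.Policy) {z : State L}
    (hz : 0 < M.stepProb π z z) {x : State L} {N N' : ℕ} (hNN : N ≤ N')
    (h : 0 < (M.stepOp π ^ N) (Set.indicator {z} 1) x) :
    0 < (M.stepOp π ^ N') (Set.indicator {z} 1) x := by
  induction N', hNN using Nat.le_induction with
  | base => exact h
  | succ n _ ih =>
    have h1 : ∀ u, 0 + M.stepProb π z z * Set.indicator {z} (1 : State L → ℝ) u +
        0 * Set.indicator {z} (1 : State L → ℝ) u ≤ M.stepOp π (Set.indicator {z} 1) u := by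
      intro u
      have h0 : ∀ v, 0 ≤ Set.indicator {z} (1 : State L → ℝ) v :=
        fun v => Set.indicator_nonneg (by simp) v
      by_cases hu : u = z
      · subst hu
        simpa using M.le_stepOp π h0 u u
      · simpa [hu] using (M.isMarkovOperator_stepOp π).nonneg h0 u
    have := ((M.isMarkovOperator_stepOp π).pow n).affine_le h1 x
    rw [pow_succ, Module.End.mul_apply]
    have := mul_pos hz ih
    linarith

/-- A state with a holding probability that is reachable from everywhere is reached from every
finite set after a common number of steps with a probability bounded below. -/
lemma exists_uniform_pow_stepOp (M : MMPPQueue L) (π : M.Policy) {z : State L}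
    (hz : 0 < M.stepProb π z z)
    (hreach : ∀ x, Relation.ReflTransGen (fun a b => 0 < M.stepProb π a b) x z)
    {S : Set (State L)} (hS : S.Finite) :
    ∃ N : ℕ, 0 < N ∧ ∃ a : ℝ, 0 < a ∧
      ∀ x ∈ S, a ≤ (M.stepOp π ^ N) (Set.indicator {z} 1) x := by
  choose N hN using fun x => M.exists_pow_stepOp_pos π (hreach x)
  set N₀ := hS.toFinset.sup N + 1
  have hpos : ∀ x ∈ hS.toFinset, 0 < (M.stepOp π ^ N₀) (Set.indicator {z} 1) x := fun x hx =>
    M.pow_stepOp_pos_of_le π hz ((Finset.le_sup hx).trans (Nat.le_succ _)) (hN x)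
  refine ⟨N₀, Nat.succ_pos _, ?_⟩
  rcases hS.toFinset.eq_empty_or_nonempty with h | h
  · exact ⟨1, one_pos, fun x hx => by simp_all⟩
  · obtain ⟨x₀, hx₀, hmin⟩ := hS.toFinset.exists_min_image
      (fun x => (M.stepOp π ^ N₀) (Set.indicator {z} 1) x) h
    exact ⟨_, hpos x₀ hx₀, fun x hx => hmin x (hS.mem_toFinset.2 hx)⟩

end MMPPQueue

/-! ### The phase process and its Poisson equation -/

namespace MMPPQueue

variable {L : ℕ} {Q : Matrix (Fin L) (Fin L) ℝ}

lemma IsGenerator.diag_nonpos (hQ : IsGenerator Q) (s : Fin L) : Q s s ≤ 0 := by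
  have h := hQ.row_sum s
  rw [← Finset.add_sum_erase _ _ (Finset.mem_univ s)] at h
  have : 0 ≤ ∑ r ∈ Finset.univ.erase s, Q s r :=
    Finset.sum_nonneg fun r hr => hQ.offDiag_nonneg s r (Finset.ne_of_mem_erase hr).symm
  linarith

/-- Harmonic functions of an irreducible generator are constant. -/
lemma IsGenerator.eq_of_mulVec_eq_zero (hQ : IsGenerator Q) (hirr : IsIrreducible Q)
    {v : Fin L → ℝ} (hv : ∀ s, ∑ r, Q s r * v r = 0) (s r : Fin L) : v s = v r := by
  obtain ⟨m, _, hm⟩ := Finset.exists_max_image Finset.univ v ⟨s, Finset.mem_univ s⟩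
  have hall : ∀ r, v r = v m := by
    intro r
    induction hirr m r with
    | refl => rfl
    | tail _ hab ih =>
      rename_i a b _
      -- Maximum principle: at a maximizer all terms are nonnegative and sum to zero, so every
      -- successor is a maximizer too.
      have h1 : ∑ r, Q a r * (v a - v r) = 0 := by
        simp only [mul_sub, Finset.sum_sub_distrib, hv, ← Finset.sum_mul, hQ.row_sum, zero_mul,
          sub_zero]
      have h2 : ∀ r ∈ Finset.univ, 0 ≤ Q a r * (v a - v r) := by
        intro r _
        by_cases h : a = r
        · simp [h]
        · refine mul_nonneg (hQ.offDiag_nonneg a r h) ?_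
          rw [ih]
          linarith [hm r (Finset.mem_univ r)]
      have h3 := (Finset.sum_eq_zero_iff_of_nonneg h2).1 h1 b (Finset.mem_univ b)
      have := (mul_eq_zero.1 h3).resolve_left hab.ne'
      linarith
  rw [hall s, hall r]

/-- Positivity spreads along transitions: if `p b = 0`, the balance at `b` is a sum of nonnegative
terms, so no mass can flow into `b`. -/
lemma IsStationaryVector.pos {p : Fin L → ℝ} (hp : IsStationaryVector Q p) (hQ : IsGenerator Q)
    (hirr : IsIrreducible Q) (r : Fin L) : 0 < p r := by
  obtain ⟨s, hs⟩ : ∃ s, 0 < p s := by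
    by_contra! h
    have := Finset.sum_nonpos fun s (_ : s ∈ Finset.univ) => h s
    rw [hp.sum_one] at this
    linarith
  induction hirr s r with
  | refl => exact hs
  | tail _ hab ih =>
    rename_i a b _
    refine lt_of_le_of_ne (hp.nonneg b) fun h0 => ?_
    have h1 : ∀ c ∈ Finset.univ, 0 ≤ p c * Q c b := by
      intro c _
      by_cases h : c = b
      · simp [h, ← h0]
      · exact mul_nonneg (hp.nonneg c) (hQ.offDiag_nonneg c b h)
    have h2 := (Finset.sum_eq_zero_iff_of_nonneg h1).1 (hp.balance b) a (Finset.mem_univ a)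
    exact (mul_pos ih hab).ne' h2

/-- The Poisson equation of an irreducible finite chain is solvable. -/
lemma IsStationaryVector.exists_poisson {p : Fin L → ℝ} (hp : IsStationaryVector Q p)
    (hQ : IsGenerator Q) (hirr : IsIrreducible Q) (f : Fin L → ℝ) :
    ∃ y : Fin L → ℝ, ∀ s, ∑ r, Q s r * y r = ∑ r, p r * f r - f s := by
  let A : (Fin L → ℝ) →ₗ[ℝ] (Fin L → ℝ) := Q.mulVecLin
  let ℓ : (Fin L → ℝ) →ₗ[ℝ] ℝ := ∑ s, p s • LinearMap.proj s
  have hℓ : ∀ v, ℓ v = ∑ s, p s * v s := fun v => by simp [ℓ]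
  have hA : ∀ v s, A v s = ∑ r, Q s r * v r := fun v s => rfl
  have hle : LinearMap.range A ≤ LinearMap.ker ℓ := by
    rintro _ ⟨v, rfl⟩
    rw [LinearMap.mem_ker, hℓ]
    simp only [hA, Finset.mul_sum]
    rw [Finset.sum_comm]
    simp only [← mul_assoc, ← Finset.sum_mul, hp.balance, zero_mul, Finset.sum_const_zero]
  -- Harmonic functions are constant, so by rank–nullity the range of `A` has dimension at least
  -- that of `ker ℓ`, and the inclusion `hle` is an equality.
  have hkerA : Module.finrank ℝ (LinearMap.ker A) ≤ 1 := by
    refine finrank_le_one (⟨1, ?_⟩ : LinearMap.ker A) fun w => ?_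
    · rw [LinearMap.mem_ker]
      ext s
      simpa [hA] using hQ.row_sum s
    · rcases isEmpty_or_nonempty (Fin L) with h | ⟨⟨s₀⟩⟩
      · exact ⟨0, Subtype.ext (Subsingleton.elim _ _)⟩
      · refine ⟨w.1 s₀, Subtype.ext (funext fun s => ?_)⟩
        have : ∀ s, ∑ r, Q s r * w.1 r = 0 := fun s => by
          rw [← hA, LinearMap.mem_ker.1 w.2]; rfl
        simpa using hQ.eq_of_mulVec_eq_zero hirr this s₀ s
  have hrangeℓ : Module.finrank ℝ (LinearMap.range ℓ) = 1 := by
    have : LinearMap.range ℓ = ⊤ := by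
      rw [LinearMap.range_eq_top]
      intro c
      exact ⟨fun _ => c, by rw [hℓ, ← Finset.sum_mul, hp.sum_one, one_mul]⟩
    rw [this, finrank_top, Module.finrank_self]
  have h1 := LinearMap.finrank_range_add_finrank_ker A
  have h2 := LinearMap.finrank_range_add_finrank_ker ℓ
  have heq := Submodule.eq_of_le_of_finrank_le hle (by omega)
  have hmem : (fun s => ∑ r, p r * f r - f s) ∈ LinearMap.ker ℓ := by
    rw [LinearMap.mem_ker, hℓ]
    simp only [mul_sub, Finset.sum_sub_distrib, ← Finset.sum_mul, hp.sum_one, one_mul, sub_self]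
  rw [← heq] at hmem
  obtain ⟨y, hy⟩ := hmem
  exact ⟨y, fun s => by rw [← hA, hy]⟩

end MMPPQueue

/-! ### Poisson and time averages; the gain as a limit -/

/-- A bounded function converging along `𝓖` has convergent averages against probability measures
that asymptotically concentrate on `𝓖`. -/
lemma tendsto_lintegral_of_tendsto_of_concentrating {α ι : Type*} [MeasurableSpace α]
    {μ : ι → Measure α} {u : Filter ι} {𝓖 : Filter α} (hμ1 : ∀ᶠ i in u, μ i Set.univ = 1)
    (hμ : ∀ A ∈ 𝓖, ∃ S ⊆ A, MeasurableSet S ∧ Tendsto (fun i => μ i Sᶜ) u (nhds 0))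
    {F : α → ℝ≥0∞} {B l : ℝ≥0∞} (hFB : ∀ x, F x ≤ B) (hB : B ≠ ∞) (hl : l ≠ ∞)
    (hF : Tendsto F 𝓖 (nhds l)) : Tendsto (fun i => ∫⁻ x, F x ∂μ i) u (nhds l) := by
  rw [ENNReal.tendsto_nhds hl] at hF ⊢
  intro ε hε
  have hε2 : 0 < ε / 2 := ENNReal.half_pos hε.ne'
  obtain ⟨S, hSA, hS, hS0⟩ := hμ _ (hF (ε / 2) hε2)
  have small : ∀ c : ℝ≥0∞, c ≠ ∞ → ∀ᶠ i in u, c * μ i Sᶜ ≤ ε / 2 := by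
    intro c hc
    have : Tendsto (fun i => c * μ i Sᶜ) u (nhds 0) := by
      simpa using ENNReal.Tendsto.const_mul hS0 (Or.inr hc)
    exact (this.eventually_lt_const hε2).mono fun i hi => hi.le
  filter_upwards [hμ1, small B hB, small l hl] with i h1 h2 h3
  have hind : ∀ c : ℝ≥0∞, ∫⁻ x, Sᶜ.indicator (fun _ => c) x ∂μ i = c * μ i Sᶜ :=
    fun c => lintegral_indicator_const hS.compl c
  have hmeas : ∀ c : ℝ≥0∞, Measurable (Sᶜ.indicator fun _ : α => c) :=
    fun c => measurable_const.indicator hS.compl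
  constructor
  · rw [tsub_le_iff_right]
    -- `F` need not be measurable: integrals are split only where the other summand is measurable.
    calc l = ∫⁻ _, l ∂μ i := by rw [lintegral_const, h1, mul_one]
      _ ≤ ∫⁻ x, (F x + (ε / 2 + Sᶜ.indicator (fun _ => l) x)) ∂μ i := by
        refine lintegral_mono fun x => ?_
        by_cases hx : x ∈ S
        · have := tsub_le_iff_right.1 (hSA hx).1
          simpa [hx] using this
        · simp only [Set.mem_compl_iff, hx, not_false_eq_true, Set.indicator_of_mem]
          exact le_add_left le_add_self
      _ = ∫⁻ x, F x ∂μ i + (ε / 2 + l * μ i Sᶜ) := by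
        rw [lintegral_add_right _ ((hmeas l).const_add (ε / 2)),
          lintegral_add_right _ (hmeas l), hind, lintegral_const, h1, mul_one]
      _ ≤ ∫⁻ x, F x ∂μ i + ε := by
        gcongr
        exact (add_le_add_right h3 _).trans (ENNReal.add_halves ε).le
  · calc ∫⁻ x, F x ∂μ i
      _ ≤ ∫⁻ x, (l + ε / 2 + Sᶜ.indicator (fun _ => B) x) ∂μ i := by
        refine lintegral_mono fun x => ?_
        by_cases hx : x ∈ S
        · simpa [hx] using (hSA hx).2
        · simp only [Set.mem_compl_iff, hx, not_false_eq_true, Set.indicator_of_mem]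
          exact (hFB x).trans le_add_self
      _ = l + ε / 2 + B * μ i Sᶜ := by
        rw [lintegral_add_right _ (hmeas B), hind, lintegral_const, h1, mul_one]
      _ ≤ l + ε := by
        rw [add_assoc]
        exact add_le_add_right ((add_le_add_right h2 _).trans (ENNReal.add_halves ε).le) _

lemma tendsto_poissonMeasure_singleton (k : ℕ) :
    Tendsto (fun r : ℝ≥0 => poissonMeasure r {k}) atTop (nhds 0) := by
  simp only [poissonMeasure_singleton]
  rw [← ENNReal.ofReal_zero]
  refine ENNReal.tendsto_ofReal ?_
  have h := ((Real.tendsto_pow_mul_exp_neg_atTop_nhds_zero k).div_const (k.factorial : ℝ)).comp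
    (NNReal.tendsto_coe_atTop.2 tendsto_id)
  rw [zero_div] at h
  refine h.congr fun r => ?_
  simp [mul_comm]

/-- Poissonian averages of a convergent sequence converge as the Poisson rate grows. -/
lemma tendsto_lintegral_poissonMeasure {b : ℕ → ℝ≥0∞} {B l : ℝ≥0∞} (hbB : ∀ k, b k ≤ B)
    (hB : B ≠ ∞) (hl : l ≠ ∞) (hb : Tendsto b atTop (nhds l)) :
    Tendsto (fun r : ℝ≥0 => ∫⁻ k, b k ∂poissonMeasure r) atTop (nhds l) := by
  refine tendsto_lintegral_of_tendsto_of_concentrating (𝓖 := atTop)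
    (Eventually.of_forall fun r => measure_univ) (fun A hA => ?_) hbB hB hl hb
  obtain ⟨K, hK⟩ := mem_atTop_sets.1 hA
  refine ⟨Set.Ici K, hK, measurableSet_Ici, ?_⟩
  have h : ∀ r : ℝ≥0, poissonMeasure r (Set.Ici K)ᶜ =
      ∑ k ∈ Finset.range K, poissonMeasure r {k} := by
    intro r
    rw [sum_measure_singleton]
    congr 1
    ext k
    simp
  simp only [h]
  simpa using tendsto_finsetSum (Finset.range K) fun k _ => tendsto_poissonMeasure_singleton k

/-- Time averages of a bounded convergent function converge. -/
lemma tendsto_lintegral_Ioc_div {F : ℝ → ℝ≥0∞} {B l : ℝ≥0∞} (hFB : ∀ x, F x ≤ B) (hB : B ≠ ∞)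
    (hl : l ≠ ∞) (hF : Tendsto F atTop (nhds l)) :
    Tendsto (fun t : ℝ => (∫⁻ u in Set.Ioc 0 t, F u) / ENNReal.ofReal t) atTop (nhds l) := by
  have h := tendsto_lintegral_of_tendsto_of_concentrating (𝓖 := atTop) (u := atTop)
    (μ := fun t : ℝ => (ENNReal.ofReal t)⁻¹ • volume.restrict (Set.Ioc 0 t)) ?_ ?_ hFB hB hl hF
  · refine h.congr fun t => ?_
    rw [lintegral_smul_measure, smul_eq_mul, mul_comm, ENNReal.div_eq_inv_mul, mul_comm]
  · filter_upwards [eventually_gt_atTop 0] with t ht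
    simp only [Measure.smul_apply, Measure.restrict_apply_univ, Real.volume_Ioc, sub_zero,
      smul_eq_mul]
    exact ENNReal.inv_mul_cancel (by simpa using ht) ENNReal.ofReal_ne_top
  · intro A hA
    obtain ⟨U, hU⟩ := mem_atTop_sets.1 hA
    refine ⟨Set.Ici U, hU, measurableSet_Ici, ?_⟩
    have hle : ∀ t : ℝ, ((ENNReal.ofReal t)⁻¹ • volume.restrict (Set.Ioc 0 t)) (Set.Ici U)ᶜ ≤
        (ENNReal.ofReal t)⁻¹ * ENNReal.ofReal U := by
      intro t
      rw [Measure.smul_apply, smul_eq_mul, Measure.restrict_apply measurableSet_Ici.compl]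
      gcongr
      calc volume ((Set.Ici U)ᶜ ∩ Set.Ioc 0 t) ≤ volume (Set.Ioc 0 U) := by
            refine measure_mono fun x hx => ⟨hx.2.1, ?_⟩
            exact (not_le.1 (show ¬ U ≤ x from hx.1)).le
        _ = ENNReal.ofReal U := by simp
    refine tendsto_of_tendsto_of_tendsto_of_le_of_le tendsto_const_nhds ?_ (fun _ => zero_le) hle
    have := ENNReal.Tendsto.mul_const (b := ENNReal.ofReal U)
      (tendsto_inv_iff.2 ENNReal.tendsto_ofReal_atTop) (Or.inr ENNReal.ofReal_ne_top)
    simpa using this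

namespace MMPPQueue

variable {L : ℕ}

/-- If the expected cost rate of the uniformized chain converges, its limit is the gain. -/
lemma gain_eq_of_tendsto (M : MMPPQueue L) (π : M.Policy) (hν : 0 < M.unifRate)
    (hc : ∀ x, 0 ≤ M.costRate π x) {l : ℝ} {x : State L}
    (hl : Tendsto (fun k => (M.stepOp π ^ k) (M.costRate π) x) atTop (nhds l)) :
    M.gain π x = ENNReal.ofReal l := by
  obtain ⟨B, hB⟩ := hl.bddAbove_range
  set b : ℕ → ℝ≥0∞ := fun k => ENNReal.ofReal ((M.stepOp π ^ k) (M.costRate π) x)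
  have hbB : ∀ k, b k ≤ ENNReal.ofReal B := fun k => ENNReal.ofReal_le_ofReal (hB ⟨k, rfl⟩)
  have hF : ∀ u, ∑' y, M.law π u x y * ENNReal.ofReal (M.costRate π y) =
      ∫⁻ k, b k ∂poissonMeasure (M.unifRate * u).toNNReal := by
    intro u
    rw [M.tsum_law_mul π hc, lintegral_countable']
    exact tsum_congr fun k => by rw [Measure.toPMF_apply, mul_comm]
  have hr : Tendsto (fun u : ℝ => (M.unifRate * u).toNNReal) atTop atTop :=
    tendsto_real_toNNReal_atTop.comp (tendsto_id.const_mul_atTop hν)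
  have hlim := (tendsto_lintegral_poissonMeasure hbB ENNReal.ofReal_ne_top
    ENNReal.ofReal_ne_top (ENNReal.tendsto_ofReal hl)).comp hr
  refine Tendsto.limsup_eq ?_
  simp only [totalCost, hF]
  refine tendsto_lintegral_Ioc_div (B := ENNReal.ofReal B) (fun u => ?_)
    ENNReal.ofReal_ne_top ENNReal.ofReal_ne_top hlim
  calc _ ≤ ∫⁻ _, ENNReal.ofReal B ∂poissonMeasure (M.unifRate * u).toNNReal :=
        lintegral_mono hbB
    _ = ENNReal.ofReal B := by simp

end MMPPQueue

/-! ### Necessity: stationary laws force the mean arrival rate below `ubar` -/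

/-- If the Poissonian averages of a sequence in `[0, 1]` do not depend on the rate, its first two
terms agree. -/
lemma le_of_hasSum_poisson {c : ℕ → ℝ} (hc : ∀ k, c k ∈ Set.Icc (0 : ℝ) 1)
    (h : ∀ r : ℝ, 0 ≤ r → HasSum (fun k => r ^ k / (k.factorial : ℝ) * (c k - c 0)) 0) :
    c 0 ≤ c 1 := by
  refine le_of_forall_pos_le_add fun ε hε => ?_
  set r := min ε 1
  have hr0 : 0 < r := lt_min hε one_pos
  have hr1 : r ≤ 1 := min_le_right _ _
  have hexp : HasSum (fun k => r ^ k / (k.factorial : ℝ)) (Real.exp r) := by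
    rw [Real.exp_eq_exp_ℝ]; exact NormedSpace.expSeries_div_hasSum_exp r
  have h0 := hasSum_ite_eq 0 (1 : ℝ)
  -- The comparison series is exact at `k = 0, 1` and uses `c k - c 0 ≤ 1` afterwards. It gives `0 ≤
  -- (exp r - 1 - r) + r * (c 1 - c 0) ≤ r * (r + c 1 - c 0)`.
  have h1 := hasSum_ite_eq 1 (r - r * (c 1 - c 0))
  have hle := hasSum_le (fun k => ?_) (h r hr0.le) ((hexp.sub h0).sub h1)
  · have := (abs_le.1 (Real.abs_exp_sub_one_sub_id_le (x := r) (by rwa [abs_of_pos hr0]))).2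
    have h2 : 0 ≤ r * (r + (c 1 - c 0)) := by nlinarith
    have := nonneg_of_mul_nonneg_right h2 hr0
    linarith [min_le_left ε 1]
  · rcases k with _ | _ | k
    · simp
    · simp
    · have hk : 0 ≤ r ^ (k + 2) / ((k + 2).factorial : ℝ) := by positivity
      have : c (k + 2) - c 0 ≤ 1 := by linarith [(hc (k + 2)).2, (hc 0).1]
      simpa using mul_le_of_le_one_right hk this

lemma eq_of_hasSum_poisson {c : ℕ → ℝ} (hc : ∀ k, c k ∈ Set.Icc (0 : ℝ) 1)
    (h : ∀ r : ℝ, 0 ≤ r → HasSum (fun k => r ^ k / (k.factorial : ℝ) * (c k - c 0)) 0) :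
    c 1 = c 0 := by
  refine le_antisymm ?_ (le_of_hasSum_poisson hc h)
  have := le_of_hasSum_poisson (c := fun k => 1 - c k)
    (fun k => ⟨by linarith [(hc k).2], by linarith [(hc k).1]⟩)
    (fun r hr => by
      have := (h r hr).neg
      rw [neg_zero] at this
      exact this.congr_fun fun k => by ring)
  linarith

namespace MMPPQueue

variable {L : ℕ}

/-- A stationary distribution of the continuous-time chain is invariant for the uniformized one. -/
lemma bind_step_of_bind_law (M : MMPPQueue L) (π : M.Policy) (hν : 0 < M.unifRate)
    {q : PMF (State L)} (hq : ∀ t : ℝ, 0 ≤ t → q.bind (M.law π t) = q) :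
    q.bind (M.step π) = q := by
  have hc0 : q.bind (M.chain π 0) = q := PMF.bind_pure q
  have hc1 : M.chain π 1 = M.step π := funext fun x => PMF.bind_pure _
  ext z
  set c : ℕ → ℝ := fun k => (q.bind (M.chain π k) z).toReal with hc
  have hcmem : ∀ k, c k ∈ Set.Icc (0 : ℝ) 1 := fun k =>
    ⟨ENNReal.toReal_nonneg, ENNReal.toReal_le_of_le_ofReal zero_le_one
      (by rw [ENNReal.ofReal_one]; exact PMF.coe_le_one _ z)⟩
  have key : c 1 = c 0 := by
    refine eq_of_hasSum_poisson hcmem fun r hr => ?_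
    have h1 := hq (r / M.unifRate) (by positivity)
    have hr' : M.unifRate * (r / M.unifRate) = r := by field_simp
    set w := (poissonMeasure (M.unifRate * (r / M.unifRate)).toNNReal).toPMF with hw
    have h3 : ∑' k, w k * q.bind (M.chain π k) z = q z := by
      conv_rhs => rw [← h1, M.bind_law, PMF.bind_apply]
    have hval : ∀ k, (w k * q.bind (M.chain π k) z).toReal =
        Real.exp (-r) * (r ^ k / (k.factorial : ℝ)) * c k := by
      intro k
      rw [ENNReal.toReal_mul, hw, Measure.toPMF_apply, ← measureReal_def,
        poissonMeasure_real_singleton, hr', Real.coe_toNNReal r hr, mul_div_assoc]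
    have hqz : q z ≠ ∞ := PMF.apply_ne_top _ _
    have h4 : HasSum (fun k => Real.exp (-r) * (r ^ k / (k.factorial : ℝ)) * c k) (c 0) := by
      have := ENNReal.hasSum_toReal (h3.trans_ne hqz)
      rw [← ENNReal.tsum_toReal_eq fun k => ENNReal.mul_ne_top (PMF.apply_ne_top _ _)
        (PMF.apply_ne_top _ _), h3] at this
      simp only [hval] at this
      simpa only [hc, hc0] using this
    have h5 : HasSum (fun k => r ^ k / (k.factorial : ℝ)) (Real.exp r) := by
      rw [Real.exp_eq_exp_ℝ]; exact NormedSpace.expSeries_div_hasSum_exp r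
    have h6 := (h4.mul_left (Real.exp r)).sub (h5.mul_right (c 0))
    rw [sub_self] at h6
    refine h6.congr_fun fun k => ?_
    rw [Real.exp_neg]
    field_simp
  have := (ENNReal.toReal_eq_toReal_iff' (PMF.apply_ne_top _ _) (PMF.apply_ne_top _ _)).1 key
  rwa [hc1, hc0] at this

lemma hasSum_toReal {α : Type*} (q : PMF α) : HasSum (fun x => (q x).toReal) 1 := by
  have := ENNReal.hasSum_toReal q.tsum_coe_ne_top
  rwa [← ENNReal.tsum_toReal_eq q.apply_ne_top, q.tsum_coe, ENNReal.toReal_one] at this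

lemma summable_toReal_mul {α : Type*} (q : PMF α) {φ : α → ℝ} {B : ℝ} (hφ : ∀ x, |φ x| ≤ B) :
    Summable fun x => (q x).toReal * φ x := by
  refine Summable.of_norm_bounded ((hasSum_toReal q).summable.mul_right B) fun x => ?_
  rw [norm_mul, Real.norm_of_nonneg ENNReal.toReal_nonneg]
  exact mul_le_mul_of_nonneg_left (hφ x) ENNReal.toReal_nonneg

lemma tsum_mul_stepOp (M : MMPPQueue L) (π : M.Policy) {q : PMF (State L)}
    (hq : q.bind (M.step π) = q) {φ : State L → ℝ} (hφ : ∀ x, 0 ≤ φ x) :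
    ∑' x, (q x).toReal * M.stepOp π φ x = ∑' x, (q x).toReal * φ x := by
  have h : ∑' x, q x * ENNReal.ofReal (M.stepOp π φ x) = ∑' x, q x * ENNReal.ofReal (φ x) := by
    conv_rhs => rw [← hq]
    simp only [PMF.bind_apply, ← ENNReal.tsum_mul_right]
    rw [ENNReal.tsum_comm]
    simp only [mul_assoc, ENNReal.tsum_mul_left, M.tsum_step_mul π hφ]
  -- No summability is needed: for an infinite sum both sides take the default value 0.
  have h2 : ∀ ψ : State L → ℝ, (∀ x, 0 ≤ ψ x) →
      (∑' x, q x * ENNReal.ofReal (ψ x)).toReal = ∑' x, (q x).toReal * ψ x := by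
    intro ψ hψ
    rw [ENNReal.tsum_toReal_eq fun x => ENNReal.mul_ne_top (q.apply_ne_top x)
      ENNReal.ofReal_ne_top]
    exact tsum_congr fun x => by rw [ENNReal.toReal_mul, ENNReal.toReal_ofReal (hψ x)]
  rw [← h2 φ hφ, ← h2 _ ((M.isMarkovOperator_stepOp π).nonneg hφ), h]

/-- In the support of an invariant distribution there is a state without service. -/
lemma exists_rate_eq_zero (M : MMPPQueue L) (π : M.Policy) (hν : 0 < M.unifRate)
    {q : PMF (State L)} (hq : q.bind (M.step π) = q) :
    ∃ x, q x ≠ 0 ∧ π.rate x.1 x.2 = 0 := by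
  classical
  have hex : ∃ n s, q (n, s) ≠ 0 := by
    obtain ⟨x, hx⟩ := q.support_nonempty
    exact ⟨x.1, x.2, hx⟩
  -- At the lowest level charged by `q`, a positive service rate would carry mass one level further
  -- down.
  obtain ⟨s, hs⟩ := Nat.find_spec hex
  refine ⟨(Nat.find hex, s), hs, ?_⟩
  by_contra hr
  rcases hn : Nat.find hex with _ | k
  · rw [hn] at hr
    exact hr (π.rate_zero s)
  · rw [hn] at hr hs
    have hstep : 0 < M.stepProb π (k + 1, s) (k, s) := by
      rw [M.stepProb_service]
      exact div_pos (lt_of_le_of_ne (π.rate_mem _ _).1 (Ne.symm hr)) hν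
    refine Nat.find_min hex (m := k) (by omega) ⟨s, ?_⟩
    rw [← hq, PMF.bind_apply]
    intro h0
    have := ENNReal.tsum_eq_zero.1 h0 (k + 1, s)
    rcases mul_eq_zero.1 this with h | h
    · exact hs h
    · rw [step, PMF.ofFinset_apply, ENNReal.ofReal_eq_zero] at h
      linarith

/-- Under an invariant distribution the mean arrival rate is below the maximum service rate. -/
lemma mean_arrival_le (M : MMPPQueue L) (π : M.Policy) (hν : 0 < M.unifRate)
    {q : PMF (State L)} (hq : q.bind (M.step π) = q) {p : Fin L → ℝ}
    (hp : IsStationaryVector M.Q p) {x₀ : State L} (hx₀ : π.rate x₀.1 x₀.2 = 0) :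
    ∑ s, p s * M.lam s ≤ M.ubar * (1 - (q x₀).toReal) := by
  classical
  set ρ := ∑ s, p s * M.lam s with hρ
  obtain ⟨y, hy⟩ := hp.exists_poisson M.isGenerator M.irreducible M.lam
  set Λ := ∑ s, M.lam s
  have hΛ : ∀ s, M.lam s ≤ Λ := fun s =>
    Finset.single_le_sum (fun r _ => M.lam_nonneg r) (Finset.mem_univ s)
  have hΛ0 : 0 ≤ Λ := Finset.sum_nonneg fun r _ => M.lam_nonneg r
  set Y := ∑ s, |y s|
  have hY : ∀ s, |y s| ≤ Y := fun s =>
    Finset.single_le_sum (fun r _ => abs_nonneg (y r)) (Finset.mem_univ s)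
  have hsum := hasSum_toReal q
  let tail : ℕ → State L → ℝ := fun N x => if N ≤ x.1 then 1 else 0
  have htail_abs : ∀ N x, |tail N x| ≤ 1 := by
    intro N x; simp only [tail]; split_ifs <;> simp
  have hineq : ∀ N, ρ - M.ubar * (1 - (q x₀).toReal) ≤ Λ * ∑' x, (q x).toReal * tail N x := by
    intro N
    -- The truncation at `N` makes `φ` bounded, hence integrable under `q` without any moment
    -- assumption; the shift `Y` makes it nonnegative.
    let φ : State L → ℝ := fun x => (y x.2 + Y) + ((min x.1 N : ℕ) : ℝ)
    have hφ0 : ∀ x, 0 ≤ φ x := by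
      intro x
      have := (abs_le.1 (hY x.2)).1
      have h2 : (0 : ℝ) ≤ ((min x.1 N : ℕ) : ℝ) := Nat.cast_nonneg _
      simp only [φ]; linarith
    have hφB : ∀ x, φ x ≤ 2 * Y + N := by
      intro x
      have := (abs_le.1 (hY x.2)).2
      have h2 : ((min x.1 N : ℕ) : ℝ) ≤ N := by exact_mod_cast min_le_right _ _
      simp only [φ]; linarith
    have hφabs : ∀ x, |φ x| ≤ 2 * Y + N := fun x => by rw [abs_of_nonneg (hφ0 x)]; exact hφB x
    have hTφabs : ∀ x, |M.stepOp π φ x| ≤ 2 * Y + N := fun x => by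
      rw [abs_of_nonneg ((M.isMarkovOperator_stepOp π).nonneg hφ0 x)]
      simpa using (M.isMarkovOperator_stepOp π).le_affine (a := 2 * Y + N) (b := 0) (c := 0)
        (f := φ) (g := φ) (by simpa using hφB) x
    -- The Poisson equation cancels `lam s` below the truncation, at or above it at most `Λ` is
    -- lost, and service removes at most `ubar`, but nothing at `x₀`.
    have hdrift : ∀ x, (ρ - Λ * tail N x - M.ubar + M.ubar * (if x = x₀ then 1 else 0)) /
        M.unifRate ≤ M.stepOp π φ x - φ x := by
      rintro ⟨n, s⟩
      rw [M.stepOp_eq, add_sub_cancel_left]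
      refine div_le_div_of_nonneg_right ?_ hν.le
      have h1 : ∑ r, M.Q s r * φ (n, r) = ρ - M.lam s := by
        simp only [φ, mul_add, Finset.sum_add_distrib, ← Finset.sum_mul, hy,
          M.isGenerator.row_sum, zero_mul, add_zero, hρ]
      have h2 : -Λ * tail N (n, s) ≤
          -M.lam s + M.lam s * (φ (n + 1, s) - φ (n, s)) := by
        simp only [φ, tail]
        split_ifs with h
        · rw [min_eq_right h, min_eq_right (by omega)]
          linarith [hΛ s]
        · rw [min_eq_left (by omega), min_eq_left (by omega)]
          push_cast; linarith
      have h3 : -M.ubar + M.ubar * (if ((n, s) : State L) = x₀ then 1 else 0) ≤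
          π.rate n s * (φ (n - 1, s) - φ (n, s)) := by
        split_ifs with h
        · rw [← h] at hx₀
          simp only at hx₀
          rw [hx₀]; linarith
        · have h4 : (-1 : ℝ) ≤ φ (n - 1, s) - φ (n, s) := by
            simp only [φ]
            have : min n N ≤ min (n - 1) N + 1 := by omega
            have : ((min n N : ℕ) : ℝ) ≤ ((min (n - 1) N : ℕ) : ℝ) + 1 := by exact_mod_cast this
            linarith
          have := mul_le_mul_of_nonneg_left h4 (π.rate_mem n s).1
          linarith [(π.rate_mem n s).2]
      rw [h1]
      linarith
    have hsq : Summable fun x => (q x).toReal * φ x := summable_toReal_mul q hφabs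
    have hsT : Summable fun x => (q x).toReal * M.stepOp π φ x := summable_toReal_mul q hTφabs
    have hRHS : HasSum (fun x => (q x).toReal * (M.stepOp π φ x - φ x)) 0 := by
      have := hsT.hasSum.sub hsq.hasSum
      rw [M.tsum_mul_stepOp π hq hφ0, sub_self] at this
      exact this.congr_fun fun x => by ring
    have hst : HasSum (fun x => (q x).toReal * tail N x) (∑' x, (q x).toReal * tail N x) :=
      (summable_toReal_mul q (htail_abs N)).hasSum
    have hsa : HasSum (fun x => (q x).toReal * (if x = x₀ then 1 else 0)) (q x₀).toReal := by
      have := hasSum_ite_eq x₀ (q x₀).toReal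
      refine this.congr_fun fun x => ?_
      split_ifs with h <;> simp [h]
    have hLHS := (((hsum.mul_right (ρ - M.ubar)).sub (hst.mul_left Λ)).add
      (hsa.mul_left M.ubar)).div_const M.unifRate
    have hle := hasSum_le (fun x => ?_) hLHS hRHS
    · rw [div_le_iff₀ hν] at hle
      linarith
    · have := mul_le_mul_of_nonneg_left (hdrift x) (ENNReal.toReal_nonneg (a := q x))
      refine le_trans (le_of_eq ?_) this
      ring
  have hlim : Tendsto (fun N => Λ * ∑' x, (q x).toReal * tail N x) atTop (nhds (Λ * 0)) := by
    refine Tendsto.const_mul _ ?_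
    have := tendsto_tsum_of_dominated_convergence (𝓕 := atTop) (g := fun _ : State L => (0 : ℝ))
      (f := fun N x => (q x).toReal * tail N x) hsum.summable (fun x => ?_)
      (Eventually.of_forall fun N x => ?_)
    · simpa using this
    · refine tendsto_const_nhds.congr' ?_
      filter_upwards [eventually_gt_atTop x.1] with N hN
      simp [tail, not_le.2 hN]
    · rw [norm_mul, Real.norm_of_nonneg ENNReal.toReal_nonneg]
      exact mul_le_of_le_one_right ENNReal.toReal_nonneg (htail_abs N x)
  have := ge_of_tendsto' hlim hineq
  linarith

lemma unifRate_pos (M : MMPPQueue L) (hpos : 0 < M.ubar ∨ ∃ s, 0 < M.lam s) :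
    0 < M.unifRate := by
  have h1 : 0 ≤ ∑ s, -M.Q s s := Finset.sum_nonneg fun s _ => M.diag_nonpos s
  have h2 : 0 ≤ ∑ s, M.lam s := Finset.sum_nonneg fun s _ => M.lam_nonneg s
  have h3 := M.ubar_nonneg
  unfold unifRate
  rcases hpos with h | ⟨s, hs⟩
  · linarith
  · have : M.lam s ≤ ∑ s, M.lam s :=
      Finset.single_le_sum (fun r _ => M.lam_nonneg r) (Finset.mem_univ s)
    linarith

/-- For `ubar > 0` the mass of the state without service makes the bound strict. For `ubar = 0` some
arrival rate is positive and every phase has positive weight, contradicting that the mean arrival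
rate is at most 0. -/
lemma mean_arrival_lt_of_stable (M : MMPPQueue L) (hpos : 0 < M.ubar ∨ ∃ s, 0 < M.lam s)
    {p : Fin L → ℝ} (hp : IsStationaryVector M.Q p) {π : M.Policy} (hπ : M.Stable π) :
    ∑ s, p s * M.lam s < M.ubar := by
  have hν := M.unifRate_pos hpos
  obtain ⟨q, hq⟩ := hπ
  have hq' := M.bind_step_of_bind_law π hν hq
  obtain ⟨x₀, hqx, hx₀⟩ := M.exists_rate_eq_zero π hν hq'
  have h := M.mean_arrival_le π hν hq' hp hx₀
  have hqpos : 0 < (q x₀).toReal := ENNReal.toReal_pos hqx (q.apply_ne_top x₀)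
  rcases M.ubar_nonneg.lt_or_eq with hu | hu
  · linarith [mul_pos hu hqpos]
  · exfalso
    rw [← hu, zero_mul] at h
    obtain ⟨s, hs⟩ := hpos.resolve_left (by rw [← hu]; exact lt_irrefl _)
    have := Finset.single_le_sum (f := fun s => p s * M.lam s)
      (fun r _ => mul_nonneg (hp.nonneg r) (M.lam_nonneg r)) (Finset.mem_univ s)
    have := mul_pos (hp.pos M.isGenerator M.irreducible s) hs
    linarith

/-! ### Sufficiency: geometric drift, reachability and domination of the cost -/

lemma IsStationaryVector.mean_nonneg {Q : Matrix (Fin L) (Fin L) ℝ} {p f : Fin L → ℝ}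
    (hp : IsStationaryVector Q p) (hf : ∀ s, 0 ≤ f s) : 0 ≤ ∑ s, p s * f s :=
  Finset.sum_nonneg fun s _ => mul_nonneg (hp.nonneg s) (hf s)

/-- For a constant service rate above the mean arrival rate, a function growing exponentially in
the queue length satisfies a geometric drift condition. -/
lemma exists_geometric_drift (M : MMPPQueue L) {m : ℝ} (hm : m ∈ Set.Icc 0 M.ubar)
    (hν : 0 < M.unifRate) {p : Fin L → ℝ} (hp : IsStationaryVector M.Q p)
    (hlt : ∑ s, p s * M.lam s < m) :
    ∃ (θ : ℝ) (y : Fin L → ℝ) (γ K : ℝ), 0 < θ ∧ 0 ≤ γ ∧ γ < 1 ∧ 0 < K ∧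
      ∀ x, M.stepOp (M.constantPolicy m hm) (fun x => Real.exp (θ * (x.1 + y x.2))) x ≤
        γ * Real.exp (θ * (x.1 + y x.2)) + K := by
  obtain ⟨y, hy⟩ := hp.exists_poisson M.isGenerator M.irreducible M.lam
  -- `B s θ` is the generator applied to `V`, divided by `V`, in a non-empty state; it does not
  -- depend on the queue length.
  let B : Fin L → ℝ → ℝ := fun s θ => ∑ r, M.Q s r * Real.exp (θ * (y r - y s)) +
    M.lam s * (Real.exp θ - 1) + m * (Real.exp (-θ) - 1)
  have hB0 : ∀ s, B s 0 = 0 := fun s => by simp [B, M.isGenerator.row_sum]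
  have hBd : ∀ s, HasDerivAt (B s) (∑ s, p s * M.lam s - m) 0 := by
    intro s
    have hlin : ∀ a : ℝ, HasDerivAt (fun θ : ℝ => Real.exp (θ * a)) a 0 := by
      intro a
      simpa using ((hasDerivAt_id (0 : ℝ)).mul_const a).exp
    have h1 : HasDerivAt (fun θ => ∑ r, M.Q s r * Real.exp (θ * (y r - y s)))
        (∑ r, M.Q s r * (y r - y s)) 0 :=
      HasDerivAt.fun_sum fun r _ => (hlin _).const_mul _
    have h2 : HasDerivAt (fun θ => M.lam s * (Real.exp θ - 1)) (M.lam s * 1) 0 := by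
      have := ((hlin 1).sub_const 1).const_mul (M.lam s)
      simpa using this
    have h3 : HasDerivAt (fun θ => m * (Real.exp (-θ) - 1)) (m * -1) 0 := by
      have := ((hlin (-1)).sub_const 1).const_mul m
      simpa using this
    have h4 : ∑ r, M.Q s r * (y r - y s) = ∑ s, p s * M.lam s - M.lam s := by
      simp only [mul_sub, Finset.sum_sub_distrib, ← Finset.sum_mul, M.isGenerator.row_sum,
        zero_mul, sub_zero, hy]
    have h5 := (h1.add h2).add h3
    rw [h4] at h5
    exact h5.congr_deriv (by ring)
  have hneg : ∀ s, ∀ᶠ θ in nhdsWithin (0 : ℝ) (Set.Ioi 0), B s θ < 0 := by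
    intro s
    have := (hBd s).tendsto_slope_zero_right.eventually_lt_const (sub_neg.2 hlt)
    filter_upwards [this, self_mem_nhdsWithin] with θ h1 hθ
    rw [zero_add, hB0, sub_zero, smul_eq_mul] at h1
    exact lt_of_not_ge fun h => h1.not_ge (mul_nonneg (inv_pos.2 hθ).le h)
  obtain ⟨θ, hθneg, hθ⟩ := ((eventually_all.2 hneg).and self_mem_nhdsWithin).exists
  have hθ : 0 < θ := hθ
  have hγ : ∀ᶠ γ in nhdsWithin (1 : ℝ) (Set.Iio 1), (∀ s, 1 + B s θ / M.unifRate < γ) ∧ 0 < γ := by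
    refine (eventually_all.2 fun s => ?_).and ?_
    · exact (eventually_gt_nhds (by
        have := div_neg_of_neg_of_pos (hθneg s) hν
        linarith)).filter_mono nhdsWithin_le_nhds
    · exact (eventually_gt_nhds one_pos).filter_mono nhdsWithin_le_nhds
  obtain ⟨γ, ⟨hγB, hγ0⟩, hγ1⟩ := (hγ.and self_mem_nhdsWithin).exists
  set V : State L → ℝ := fun x => Real.exp (θ * (x.1 + y x.2)) with hV
  set T := M.stepOp (M.constantPolicy m hm)
  have hTV : ∀ x, 0 ≤ T V x :=
    (M.isMarkovOperator_stepOp _).nonneg fun x => (Real.exp_pos _).le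
  -- The constant only has to cover the empty states, where there is no service; the summand 1 makes
  -- it positive.
  refine ⟨θ, y, γ, 1 + ∑ s, T V (0, s), hθ, hγ0.le, hγ1,
    add_pos_of_pos_of_nonneg one_pos (Finset.sum_nonneg fun s _ => hTV _), ?_⟩
  have hVpos : ∀ x, 0 < V x := fun x => Real.exp_pos _
  have hK : ∀ s, T V (0, s) ≤ ∑ s, T V (0, s) := fun s =>
    Finset.single_le_sum (f := fun s => T V (0, s)) (fun s _ => hTV _) (Finset.mem_univ s)
  rintro ⟨n, s⟩
  change T V (n, s) ≤ γ * V (n, s) + _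
  rcases n with _ | n
  · linarith [hK s, mul_pos hγ0 (hVpos (0, s))]
  · have h1 : T V (n + 1, s) = V (n + 1, s) * (1 + B s θ / M.unifRate) := by
      have e1 : ∀ r, V (n + 1, r) = V (n + 1, s) * Real.exp (θ * (y r - y s)) := fun r => by
        simp only [hV, ← Real.exp_add]; congr 1; ring
      have e2 : V (n + 1 + 1, s) = V (n + 1, s) * Real.exp θ := by
        simp only [hV, ← Real.exp_add]; congr 1; push_cast; ring
      have e3 : V (n + 1 - 1, s) = V (n + 1, s) * Real.exp (-θ) := by
        simp only [hV, ← Real.exp_add]; congr 1; push_cast; ring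
      have e4 : ∑ r, M.Q s r * V (n + 1, r) =
          V (n + 1, s) * ∑ r, M.Q s r * Real.exp (θ * (y r - y s)) := by
        rw [Finset.mul_sum]
        exact Finset.sum_congr rfl fun r _ => by rw [e1 r]; ring
      have e5 : (M.constantPolicy m hm).rate (n + 1) s = m := by simp [constantPolicy]
      simp only [T, M.stepOp_eq, e2, e3, e4, e5, B]
      ring
    have h2 : V (n + 1, s) * (1 + B s θ / M.unifRate) ≤ V (n + 1, s) * γ :=
      mul_le_mul_of_nonneg_left (hγB s).le (hVpos _).le
    have h3 := hK s
    have h4 := hTV (0, s)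
    linarith

lemma stepProb_phase (M : MMPPQueue L) (π : M.Policy) (n : ℕ) {s r : Fin L} (h : s ≠ r) :
    M.stepProb π (n, s) (n, r) = M.Q s r / M.unifRate := by
  simp [stepProb, gen, h.symm]

/-- Uniformization reserves the rate `ubar` for service, which is never used when the system is
empty. -/
lemma stepProb_empty_self_pos (M : MMPPQueue L) (π : M.Policy) (hν : 0 < M.unifRate)
    (hu : 0 < M.ubar) (s : Fin L) : 0 < M.stepProb π (0, s) (0, s) := by
  have h1 : M.stepProb π (0, s) (0, s) = 1 - (M.lam s + -M.Q s s) / M.unifRate := by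
    simp [stepProb, gen, π.rate_zero]; ring
  have h2 : M.lam s + -M.Q s s < M.unifRate := by
    have h3 := Finset.single_le_sum (f := M.lam) (fun r _ => M.lam_nonneg r) (Finset.mem_univ s)
    have h4 := Finset.single_le_sum (f := fun r => -M.Q r r) (fun r _ => M.diag_nonpos r)
      (Finset.mem_univ s)
    unfold unifRate
    linarith
  rw [h1, sub_pos, div_lt_one hν]
  exact h2

/-- Services empty the queue in the current phase; irreducibility then leads to phase `r`. -/
lemma reflTransGen_constantPolicy (M : MMPPQueue L) {m : ℝ} (hm : m ∈ Set.Icc 0 M.ubar)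
    (hν : 0 < M.unifRate) (hm0 : 0 < m) (r : Fin L) (x : State L) :
    Relation.ReflTransGen (fun a b => 0 < M.stepProb (M.constantPolicy m hm) a b) x (0, r) := by
  obtain ⟨n, s⟩ := x
  induction n with
  | zero =>
    induction M.irreducible s r with
    | refl => exact .refl
    | tail _ hab ih =>
      refine ih.tail ?_
      rw [M.stepProb_phase]
      · exact div_pos hab hν
      · rintro rfl
        linarith [M.isGenerator.diag_nonpos ‹_›]
  | succ n ih =>
    refine .head ?_ ih
    rw [M.stepProb_service]
    simpa [constantPolicy] using div_pos hm0 hν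

lemma finite_exp_sublevel {θ : ℝ} (hθ : 0 < θ) (y : Fin L → ℝ) (R : ℝ) :
    {x : State L | Real.exp (θ * (x.1 + y x.2)) ≤ R}.Finite := by
  set Y := ∑ s, |y s|
  have hY : ∀ s, |y s| ≤ Y := fun s =>
    Finset.single_le_sum (fun r _ => abs_nonneg (y r)) (Finset.mem_univ s)
  refine ((Set.finite_Iic ⌊R / θ + Y⌋₊).prod Set.finite_univ).subset ?_
  rintro ⟨n, s⟩ h
  refine ⟨Nat.le_floor ?_, Set.mem_univ _⟩
  have h1 : θ * (n + y s) ≤ R := by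
    have h2 : Real.exp (θ * (n + y s)) ≤ R := h
    linarith [Real.add_one_le_exp (θ * (n + y s))]
  have h3 : (n : ℝ) + y s ≤ R / θ := by rwa [le_div_iff₀ hθ, mul_comm]
  have := (abs_le.1 (hY s)).1
  change (n : ℝ) ≤ _
  linarith

lemma h_nonneg (M : MMPPQueue L) (n : ℕ) : 0 ≤ M.h n := by
  rw [← M.h_zero]; exact M.h_mono (Nat.zero_le n)

lemma c_nonneg (M : MMPPQueue L) {u : ℝ} (hu : u ∈ Set.Icc 0 M.ubar) : 0 ≤ M.c u := by
  rw [← M.c_zero]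
  exact M.c_strictMono.monotoneOn ⟨le_rfl, M.ubar_nonneg⟩ hu hu.1

lemma c_le (M : MMPPQueue L) {u : ℝ} (hu : u ∈ Set.Icc 0 M.ubar) : M.c u ≤ M.c M.ubar :=
  M.c_strictMono.monotoneOn hu ⟨M.ubar_nonneg, le_rfl⟩ hu.2

lemma costRate_nonneg (M : MMPPQueue L) (π : M.Policy) (x : State L) : 0 ≤ M.costRate π x :=
  add_nonneg (M.c_nonneg (π.rate_mem _ _)) (M.h_nonneg _)

/-- Polynomially growing costs are dominated by an exponential of the queue length. -/
lemma exists_costRate_le (M : MMPPQueue L) (π : M.Policy) {θ : ℝ} (hθ : 0 < θ) (y : Fin L → ℝ) :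
    ∃ C, ∀ x : State L, |M.costRate π x| ≤ C * (1 + Real.exp (θ * (x.1 + y x.2))) := by
  obtain ⟨C, k, hC, hh⟩ := M.h_poly
  set Y := ∑ s, |y s|
  have hY : ∀ s, |y s| ≤ Y := fun s =>
    Finset.single_le_sum (fun r _ => abs_nonneg (y r)) (Finset.mem_univ s)
  set D := C * (k.factorial / θ ^ k * Real.exp (θ * Y)) with hD
  have hD0 : 0 ≤ D := by positivity
  have hc0 := M.c_nonneg ⟨M.ubar_nonneg, le_rfl⟩
  refine ⟨M.c M.ubar + D, fun x => ?_⟩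
  obtain ⟨n, s⟩ := x
  rw [abs_of_nonneg (M.costRate_nonneg π _)]
  set v := Real.exp (θ * ((n : ℝ) + y s)) with hv
  have hv0 : 0 < v := Real.exp_pos _
  -- A single term of the exponential series: `(θ * n) ^ k / k! ≤ exp (θ * n)`.
  have h1 : (n : ℝ) ^ k ≤ k.factorial / θ ^ k * Real.exp (θ * n) := by
    have := Real.pow_div_factorial_le_exp (θ * n) (by positivity) k
    rw [div_le_iff₀ (by positivity), mul_pow] at this
    rw [div_mul_eq_mul_div, le_div_iff₀ (by positivity)]
    linarith
  have h2 : Real.exp (θ * n) ≤ Real.exp (θ * Y) * v := by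
    rw [hv, ← Real.exp_add]
    apply Real.exp_le_exp.2
    have := mul_le_mul_of_nonneg_left (abs_le.1 (hY s)).1 hθ.le
    linarith
  have h3 : M.h n ≤ D * v := by
    calc M.h n ≤ C * (n : ℝ) ^ k := hh n
      _ ≤ C * (k.factorial / θ ^ k * (Real.exp (θ * Y) * v)) := by
        refine mul_le_mul_of_nonneg_left (h1.trans ?_) hC
        exact mul_le_mul_of_nonneg_left h2 (by positivity)
      _ = D * v := by rw [hD]; ring
  have h4 := M.c_le (π.rate_mem n s)
  have h5 : M.costRate π (n, s) = M.c (π.rate n s) + M.h n := rfl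
  have h6 := mul_nonneg hc0 hv0.le
  rw [h5]
  linarith

/-! ### Assembly for constant policies -/

/-- A constant service rate above the mean arrival rate stabilizes the queue, with a finite gain
which does not depend on the initial state. -/
lemma stable_and_gain_constantPolicy (M : MMPPQueue L) {m : ℝ} (hm : m ∈ Set.Icc 0 M.ubar)
    {p : Fin L → ℝ} (hp : IsStationaryVector M.Q p) (hlt : ∑ s, p s * M.lam s < m) :
    M.Stable (M.constantPolicy m hm) ∧
      ∃ g : ℝ≥0, ∀ x : State L, M.gain (M.constantPolicy m hm) x = (g : ℝ≥0∞) := by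
  have hm0 : 0 < m := (hp.mean_nonneg M.lam_nonneg).trans_lt hlt
  have hu : 0 < M.ubar := hm0.trans_le hm.2
  have hν := M.unifRate_pos (Or.inl hu)
  obtain ⟨r⟩ : Nonempty (Fin L) := by
    by_contra h
    rw [not_nonempty_iff] at h
    simpa using hp.sum_one
  set π := M.constantPolicy m hm
  have hT := M.isMarkovOperator_stepOp π
  obtain ⟨θ, y, γ, K, hθ, hγ0, hγ1, hK, hd⟩ := M.exists_geometric_drift hm hν hp hlt
  set V : State L → ℝ := fun x => Real.exp (θ * (x.1 + y x.2))
  have hV : ∀ x, 0 ≤ V x := fun x => (Real.exp_pos _).le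
  have hlim : ∀ φ : State L → ℝ, ∀ C : ℝ, (∀ x, |φ x| ≤ C * (1 + V x)) →
      ∃ l, ∀ x, Tendsto (fun k => (M.stepOp π ^ k) φ x) atTop (nhds l) :=
    fun φ C hφ => hT.exists_tendsto_pow (z := (0, r)) hV hγ0 hγ1 hK hd
      (fun R => M.exists_uniform_pow_stepOp π (M.stepProb_empty_self_pos π hν hu r)
        (M.reflTransGen_constantPolicy hm hν hm0 r) (finite_exp_sublevel hθ y R)) hφ
  constructor
  · choose l hl using fun z : State L => hlim (Set.indicator {z} 1) 1 fun x => by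
      rw [abs_of_nonneg (Set.indicator_nonneg (by simp) x)]
      have : Set.indicator {z} (1 : State L → ℝ) x ≤ 1 := Set.indicator_le_self' (by simp) x
      linarith [hV x]
    obtain ⟨hl0, hl1⟩ := hT.hasSum_one_of_tendsto_pow hV hγ0 hγ1 hK hd
      (finite_exp_sublevel hθ y) (0, r) fun z => hl z (0, r)
    let q : PMF (State L) := ⟨fun z => ENNReal.ofReal (l z), by
      have := ENNReal.ofReal_tsum_of_nonneg hl0 hl1.summable
      rw [hl1.tsum_eq, ENNReal.ofReal_one] at this
      rw [this]
      exact ENNReal.summable.hasSum⟩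
    refine M.stable_of_bind_step π q (PMF.ext fun z => ?_)
    have hsupp : ∀ x, x ∉ nbhd z → M.stepProb π x z = 0 := by
      intro x hx
      refine M.stepProb_eq_zero π x z fun h => hx ?_
      simp only [nbhd, Finset.mem_product, Finset.mem_Icc, Finset.mem_univ, and_true] at h ⊢
      omega
    -- Only finitely many states lead to `z` in one step, so the limit in `k` passes through a
    -- finite sum and yields the balance equation for `l`.
    have hone : M.stepOp π (Set.indicator {z} 1) =
        ∑ x ∈ nbhd z, M.stepProb π x z • Set.indicator {x} (1 : State L → ℝ) := by
      ext x
      have h1 : M.stepOp π (Set.indicator {z} 1) x = M.stepProb π x z := by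
        rw [stepOp_apply, Finset.sum_eq_single z]
        · simp
        · intro b _ hb; simp [hb]
        · intro h
          have : M.stepProb π x z = 0 := M.stepProb_eq_zero π x z h
          simp [this]
      rw [h1, Finset.sum_apply]
      by_cases hx : x ∈ nbhd z
      · rw [Finset.sum_eq_single x]
        · simp
        · intro b _ hb; simp [hb.symm]
        · exact fun h => absurd hx h
      · rw [hsupp x hx, Finset.sum_eq_zero]
        intro b hb
        have : x ≠ b := fun h => hx (h ▸ hb)
        simp [this]
    have heq : l z = ∑ x ∈ nbhd z, M.stepProb π x z * l x := by
      refine tendsto_nhds_unique ((hl z (0, r)).comp (tendsto_add_atTop_nat 1)) ?_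
      have : ∀ k : ℕ, (M.stepOp π ^ (k + 1)) (Set.indicator {z} 1) (0, r) =
          ∑ x ∈ nbhd z, M.stepProb π x z * (M.stepOp π ^ k) (Set.indicator {x} 1) (0, r) := by
        intro k
        rw [pow_succ, Module.End.mul_apply, hone, map_sum, Finset.sum_apply]
        simp
      refine Tendsto.congr (fun k => (this k).symm) ?_
      exact tendsto_finsetSum _ fun x _ => (hl x (0, r)).const_mul _
    change ∑' x, ENNReal.ofReal (l x) * M.step π x z = ENNReal.ofReal (l z)
    rw [heq, ENNReal.ofReal_sum_of_nonneg fun x _ => mul_nonneg (M.stepProb_nonneg π x z) (hl0 x),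
      tsum_eq_sum (s := nbhd z)]
    · refine Finset.sum_congr rfl fun x _ => ?_
      rw [ENNReal.ofReal_mul (M.stepProb_nonneg π x z), mul_comm]
      rfl
    · intro x hx
      simp [step, PMF.ofFinset_apply, hsupp x hx]
  · obtain ⟨C, hC⟩ := M.exists_costRate_le π hθ y
    obtain ⟨g, hg⟩ := hlim _ C hC
    exact ⟨g.toNNReal, fun x => M.gain_eq_of_tendsto π hν (M.costRate_nonneg π) (hg x)⟩

end MMPPQueue

theorem mainTheorem4 {L : ℕ} (M : MMPPQueue L)
    (hpos : 0 < M.ubar ∨ ∃ s, 0 < M.lam s)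
    (p : Fin L → ℝ) (hp : MMPPQueue.IsStationaryVector M.Q p) :
    ((∃ π : M.Policy, M.Stable π) ↔ ∑ s, p s * M.lam s < M.ubar) ∧
    (∀ (m : ℝ) (hm : m ∈ Set.Icc 0 M.ubar), ∑ s, p s * M.lam s < m →
      M.Stable (M.constantPolicy m hm) ∧
      ∃ g : ℝ≥0, ∀ x : MMPPQueue.State L, M.gain (M.constantPolicy m hm) x = (g : ℝ≥0∞)) :=
  ⟨⟨fun ⟨_, hπ⟩ => M.mean_arrival_lt_of_stable hpos hp hπ, fun h =>
    ⟨_, (M.stable_and_gain_constantPolicy ⟨M.ubar_nonneg, le_rfl⟩ hp h).1⟩⟩,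
    fun _ hm h => M.stable_and_gain_constantPolicy hm hp h⟩
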